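/- Let $\mathscr B\subseteq\mathbb N=\{1,2,\dots\}$ be any set (finite or infinite). For $m\ge 0$ let $\mathscr B(m)$ be the set of the $m$ smallest elements of $\mathscr B$ (and $\mathscr B(m)=\mathscr B$ if $\mathscr B$ has at most $m$ elements). For $\mathscr C\subseteq\mathbb N$ let $\eta_{\mathscr C}\in\{0,1\}^{\mathbb Z}$ be the characteristic sequence of $\mathcal F_{\mathscr C}=\mathbb Z\setminus\bigcup_{b\in\mathscr C}b\mathbb Z$, and let $X_{\mathscr C}$ be the closure of the orbit of $\eta_{\mathscr C}$ under the shift $\sigma$, where $\sigma(x)_i=x_{i+1}$. For shift-invariant Borel probability measures $\mu,\mu'$ on $\{0,1\}^{\mathbb Z}$ let $$\bar d_{\mathcal M}(\mu,\mu')=\inf_{\lambda}\lambda(\{(x,y):x_0\ne y_0\})$$ be Ornstein's $\bar d$-distance, the infimum being over all joinings $\lambda$ of $\mu$ and $\mu'$, that is, over all $\sigma\times\sigma$-invariant measures with marginals $\mu$ and $\mu'$. Then, for each $m$, the measure $\nu_m$ equidistributed on the (periodic) orbit of $\eta_{\mathscr B(m)}$ is the unique ergodic shift-invariant Borel probability measure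 on $X_{\mathscr B(m)}$, and there is an ergodic shift-invariant Borel probability measure $\nu$ on $X_{\mathscr B}$ (the Mirsky measure) with the following properties. 1. $\lim_{m\to\infty}\bar d_{\mathcal M}(\nu_m,\nu)=0$. 2. There are strictly increasing sequences $(n_k)_{k\ge1}$ of positive integers such that $$\lim_{m\to\infty}\limsup_{k\to\infty}\frac1{n_k}\bigl|\{0\le j<n_k:(\eta_{\mathscr B(m)})_j\ne(\eta_{\mathscr B})_j\}\bigr|=0,$$ and for every such sequence $\eta_{\mathscr B}$ is quasi-generic for $\nu$ along $(n_k)$, that is, $\frac1{n_k}\sum_{j=0}^{n_k-1}f(\sigma^j\eta_{\mathscr B})\to\int f\,d\nu$ for every continuous $f\colon\{0,1\}^{\mathbb Z}\to\mathbb C$. 3. $\nu$ has rational discrete spectrum: the linear span of the eigenfunctions of the Koopman operator $f\mapsto f\circ\sigma$ is dense in $L^2(\nu)$, and all its eigenvalues are roots of unity. 4. The Kolmogorov–Sinai entropy of $(\sigma,\nu)$ is $0$. -/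

import Mathlib

open MeasureTheory Filter Topology
open scoped ENNReal

namespace BFree

noncomputable section

/-! ### Measure-preserving and topological systems -/

/-- The point `x` is quasi-generic for `μ` along the sequence `n`: the averages of every continuous
complex-valued function over the first `n k` points of the orbit of `x` converge to its integral. -/
def IsQuasiGeneric {X : Type*} [TopologicalSpace X] [MeasurableSpace X] (T : X → X)
    (μ : Measure X) (n : ℕ → ℕ) (x : X) : Prop :=
  ∀ f : C(X, ℂ), Tendsto (fun k => (1 / (n k : ℂ)) * ∑ j ∈ Finset.range (n k), f (T^[j] x)) atTop
    (𝓝 (∫ y, f y ∂μ))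

/-- The Koopman operator `f ↦ f ∘ T` on `L²(X, μ)` with complex coefficients. -/
def koopman {X : Type*} [MeasurableSpace X] (T : X → X) (μ : Measure X)
    (hT : MeasurePreserving T μ μ) : Module.End ℂ (Lp ℂ 2 μ) :=
  Lp.compMeasurePreservingₗ ℂ T hT

/-- The linear span of the eigenfunctions of the Koopman operator is dense in `L²(X, μ)`. -/
def HasDiscreteSpectrum {X : Type*} [MeasurableSpace X] (T : X → X) (μ : Measure X)
    (hT : MeasurePreserving T μ μ) : Prop :=
  Dense ((Submodule.span ℂ
    {f : Lp ℂ 2 μ | ∃ ξ : ℂ, (koopman T μ hT).HasEigenvector ξ f} : Submodule ℂ (Lp ℂ 2 μ)) :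
      Set (Lp ℂ 2 μ))

/-- Discrete spectrum such that every eigenvalue is rational, that is, a root of unity. -/
def HasRationalDiscreteSpectrum {X : Type*} [MeasurableSpace X] (T : X → X) (μ : Measure X)
    (hT : MeasurePreserving T μ μ) : Prop :=
  HasDiscreteSpectrum T μ hT ∧
    ∀ ξ : ℂ, (koopman T μ hT).HasEigenvalue ξ → ∃ q : ℕ, 0 < q ∧ ξ ^ q = 1

/-- The Shannon entropy of the finite partition of `X` into the fibres of `P : X → κ`. -/
def partitionEntropy {X κ : Type*} [MeasurableSpace X] [Fintype κ] (μ : Measure X)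
    (P : X → κ) : ℝ :=
  ∑ c : κ, Real.negMulLog (μ.real (P ⁻¹' {c}))

/-- The entropy of `T` with respect to the finite partition given by `P`: the exponential growth
rate of the entropies of the partitions `P ∨ T⁻¹P ∨ ⋯ ∨ T⁻⁽ᴺ⁻¹⁾P`. -/
def entropyOfPartition {X : Type*} [MeasurableSpace X] (T : X → X) (μ : Measure X) {r : ℕ}
    (P : X → Fin r) : ℝ≥0∞ :=
  limsup (fun N : ℕ => ENNReal.ofReal
    (partitionEntropy μ (fun x => fun j : Fin N => P (T^[j] x)) / N)) atTop

/-- The Kolmogorov–Sinai entropy: the supremum over all finite measurable partitions. -/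
def measureEntropy {X : Type*} [MeasurableSpace X] (T : X → X) (μ : Measure X) : ℝ≥0∞ :=
  ⨆ (r : ℕ) (P : X → Fin r) (_ : Measurable P), entropyOfPartition T μ P

/-- The joinings of `μ` and `ν`: the `T × S`-invariant measures with marginals `μ` and `ν`. -/
def joinings {X Y : Type*} [MeasurableSpace X] [MeasurableSpace Y] (T : X → X) (S : Y → Y)
    (μ : Measure X) (ν : Measure Y) : Set (Measure (X × Y)) :=
  {l | MeasurePreserving (Prod.map T S) l l ∧ l.map Prod.fst = μ ∧ l.map Prod.snd = ν}

/-! ### Two-sided symbolic dynamics over the alphabet `{0, 1}` -/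

/-- The space `{0, 1}^ℤ`, with the product topology and the product (Borel) σ-algebra. -/
abbrev FullShift : Type := ℤ → Fin 2

/-- The shift map. -/
def shift (x : FullShift) : FullShift := fun i => x (i + 1)

/-- The closure of the two-sided orbit of `x` under the shift. -/
def orbitClosure (x : FullShift) : Set FullShift :=
  closure (Set.range fun k : ℤ => ((fun i => x (i + k)) : FullShift))

/-- `μ` is a shift-invariant ergodic Borel probability measure on the subshift `Y`, regarded as a
measure on the full shift that is concentrated on `Y`. -/
structure IsErgodicMeasureOn (Y : Set FullShift) (μ : Measure FullShift) : Prop where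
  isProbabilityMeasure : IsProbabilityMeasure μ
  ergodic : Ergodic shift μ
  measure_eq_one : μ Y = 1

/-- The function `d₀(x, y)`, which is `1` if `x₀ ≠ y₀` and `0` otherwise. -/
def dZero (p : FullShift × FullShift) : ℝ≥0∞ := if p.1 0 ≠ p.2 0 then 1 else 0

/-- Ornstein's d-bar distance: the infimum of `∫ d₀ dl` over all joinings `l` of `μ` and `ν`. -/
def ornsteinDist (μ ν : Measure FullShift) : ℝ≥0∞ :=
  ⨅ l ∈ joinings shift shift μ ν, ∫⁻ p, dZero p ∂l

/-- The d-bar pseudometric along the sequence `n`: the upper density along `n` of the set of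
nonnegative coordinates at which `x` and `y` differ. -/
def dbarAlong (n : ℕ → ℕ) (x y : FullShift) : ℝ :=
  limsup (fun k => (1 / (n k : ℝ)) *
    (((Finset.range (n k)).filter fun j : ℕ => x j ≠ y j).card : ℝ)) atTop

/-- The measure equidistributed on the orbit of a shift-periodic point `x`. -/
def periodicMeasure (x : FullShift) : Measure FullShift :=
  ((Function.minimalPeriod shift x : ℝ≥0∞))⁻¹ •
    ∑ j ∈ Finset.range (Function.minimalPeriod shift x), Measure.dirac (shift^[j] x)

/-! ### `ℬ`-free integers -/

/-- The set of integers that are divisible by no element of `B`. -/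
def freeSet (B : Set ℕ) : Set ℤ := {j | ∀ b ∈ B, ¬ (b : ℤ) ∣ j}

open Classical in
/-- The characteristic sequence of the set of `B`-free integers. -/
def eta (B : Set ℕ) : FullShift := fun j => if j ∈ freeSet B then 1 else 0

/-- The `B`-free shift. -/
def freeShift (B : Set ℕ) : Set FullShift := orbitClosure (eta B)

/-- The set of the `m` smallest elements of `B` (all of `B` if it has at most `m` elements). -/
def initialPart (B : Set ℕ) (m : ℕ) : Set ℕ := {b ∈ B | {a ∈ B | a < b}.ncard < m}

/-- `n` is a strictly increasing sequence of positive integers along which the characteristic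
sequences of the `B(m)`-free integers converge to that of the `B`-free integers in upper density,
as `m → ∞`. -/
def IsDavenportErdosSeq (B : Set ℕ) (n : ℕ → ℕ) : Prop :=
  StrictMono n ∧ (∀ k, 0 < n k) ∧
    Tendsto (fun m => dbarAlong n (eta (initialPart B m)) (eta B)) atTop (𝓝 0)

end

end BFree

namespace BFree

/-! ### The shift and its periodic points -/

/-! Everything is carried by one compact model, the closure of ℤ in the product of all ℤ/n, whose
rotation by 1 is ergodic for Haar measure. A point g of it is a consistent family of residues, so "g
+ i is divisible by b" makes sense, and `code C` records which translates g + i avoid all divisors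
in C. This intertwines rotation and shift for every C at once. The Mirsky measure is the image of
Haar measure under `code B`, hence ergodic.

For finite C, g agrees with an integer modulo the product of C, so `code C g` lies on the orbit of
`eta C`; by uniqueness the image measure is the periodic one (`mirsky_eq_periodicMeasure`). Each
coordinate of `code (B(m)) g` eventually equals that of `code B g`. Dominated convergence then gives
weak convergence, and also d-bar convergence, through the joining g ↦ (`code (B(m)) g`, `code B g`).

Davenport–Erdős sequences need more: the multiples of B must have lower density at most A, the limit
of the densities of the multiples of the B(m). A Dirichlet series inequality
(`sum_rpow_le_of_tendsto_countIn`) bounds the sums of n^(-1-ε) over multiples of B by A·ζ(1+ε). A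
larger lower density would contradict this as ε → 0, because the harmonic series diverges
(`frequently_countIn_lt`). Along such a sequence `eta B` is close in density to periodic points, so
its averages follow theirs (`isQuasiGeneric_mirsky`); testing clopen sets off the subshift then
shows where the measure lives.

Spectrum and entropy rest on one fact: measurable sets of the odometer are approximated by sets
invariant under a power of the rotation (`measureDense_periodicSets`). The mean ergodic theorem
turns this into density of periodic vectors in L², and these are sums of eigenvectors for roots of
unity. For entropy, a partition close to a periodic one has names cheaply described by one period
plus rare corrections. -/

theorem shift_iterate_apply (x : FullShift) (n : ℕ) (i : ℤ) : shift^[n] x i = x (i + n) := by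
  induction n generalizing i with
  | zero => simp
  | succ n ih =>
    rw [Function.iterate_succ_apply', shift, ih]
    congr 1; push_cast; ring

theorem measurable_shift : Measurable shift :=
  measurable_pi_lambda _ fun i => measurable_pi_apply (i + 1)

theorem shift_injective : Function.Injective shift := by
  intro x y h
  funext i
  have := congrFun h (i - 1)
  simpa [shift] using this

theorem orbitClosure_eq_of_periodic {x : FullShift} (hx : x ∈ Function.periodicPts shift) :
    orbitClosure x =
      ⋃ j ∈ Finset.range (Function.minimalPeriod shift x), {shift^[j] x} := by
  set p := Function.minimalPeriod shift x with hp
  have hp0 : 0 < p := Function.minimalPeriod_pos_of_mem_periodicPts hx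
  have hper : Function.Periodic x (p : ℤ) := fun i => by
    have := congrFun (Function.isPeriodicPt_minimalPeriod shift x) i
    rwa [shift_iterate_apply] at this
  have hrange : (Set.range fun k : ℤ => ((fun i => x (i + k)) : FullShift)) =
      ⋃ j ∈ Finset.range p, {shift^[j] x} := by
    ext y
    simp only [Set.mem_range, Set.mem_iUnion, Set.mem_singleton_iff, Finset.mem_range, exists_prop]
    constructor
    · rintro ⟨k, rfl⟩
      have h1 : 0 ≤ k % (p : ℤ) := Int.emod_nonneg _ (by positivity)
      have h2 : k % (p : ℤ) < p := Int.emod_lt_of_pos _ (by positivity)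
      refine ⟨(k % p).toNat, by omega, ?_⟩
      funext i
      rw [shift_iterate_apply, Int.toNat_of_nonneg h1, ← hper.int_mul (k / p) (i + k % p)]
      congr 1
      have := Int.emod_add_mul_ediv k p
      simp only [Int.cast_id]
      linarith
    · rintro ⟨j, -, rfl⟩
      exact ⟨j, by funext i; rw [shift_iterate_apply]⟩
  rw [orbitClosure, hrange]
  exact ((Finset.range p).finite_toSet.biUnion fun _ _ => Set.finite_singleton _).isClosed.closure_eq

theorem pairwiseDisjoint_orbit (x : FullShift) :
    (↑(Finset.range (Function.minimalPeriod shift x)) : Set ℕ).PairwiseDisjoint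
      fun j => ({shift^[j] x} : Set FullShift) := by
  intro i hi j hj hij
  rw [Function.onFun, Set.disjoint_singleton]
  intro h
  exact hij (Function.iterate_injOn_Iio_minimalPeriod (by simpa using hi) (by simpa using hj) h)

/-- Since the shift is injective, the preimage of an orbit point is the single preceding point, so
invariance forces equal masses on the finite orbit. Ergodicity plays no role. -/
theorem eq_periodicMeasure {x : FullShift} (hx : x ∈ Function.periodicPts shift)
    {μ : Measure FullShift} [IsProbabilityMeasure μ] (hμ : MeasurePreserving shift μ μ)
    (h1 : μ (orbitClosure x) = 1) : μ = periodicMeasure x := by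
  rw [orbitClosure_eq_of_periodic hx] at h1
  have hmass : ∀ j, μ {shift^[j] x} = μ {x} := by
    intro j
    induction j with
    | zero => simp
    | succ j ih =>
      rw [← ih, ← hμ.measure_preimage (MeasurableSet.singleton _).nullMeasurableSet]
      congr 1
      ext y
      rw [Set.mem_preimage, Set.mem_singleton_iff, Set.mem_singleton_iff,
        Function.iterate_succ_apply']
      exact shift_injective.eq_iff
  have key : ∀ S, MeasurableSet S → μ S =
      ∑ j ∈ Finset.range (Function.minimalPeriod shift x),
        μ {x} * Measure.dirac (shift^[j] x) S := by
    intro S hS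
    have hY : MeasurableSet
        (⋃ j ∈ Finset.range (Function.minimalPeriod shift x), ({shift^[j] x} : Set FullShift)) :=
      Finset.measurableSet_biUnion _ fun _ _ => MeasurableSet.singleton _
    rw [← measure_inter_conull ((prob_compl_eq_zero_iff hY).2 h1), Set.inter_iUnion₂,
      measure_biUnion_finset
        ((pairwiseDisjoint_orbit x).mono fun _ => Set.inter_subset_right)
        fun _ _ => hS.inter (MeasurableSet.singleton _)]
    refine Finset.sum_congr rfl fun j _ => ?_
    rw [Measure.dirac_apply' _ hS]
    by_cases h : shift^[j] x ∈ S
    · rw [Set.inter_eq_right.2 (Set.singleton_subset_iff.2 h), hmass, Set.indicator_of_mem h]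
      simp
    · rw [Set.inter_singleton_eq_empty.2 h, Set.indicator_of_notMem h]
      simp
  have hx1 : (Function.minimalPeriod shift x : ℝ≥0∞) * μ {x} = 1 := by
    have := key Set.univ MeasurableSet.univ
    simpa using this.symm
  have hx2 : μ {x} = (Function.minimalPeriod shift x : ℝ≥0∞)⁻¹ :=
    ENNReal.eq_inv_of_mul_eq_one_left (by rwa [mul_comm])
  ext S hS
  rw [key S hS, periodicMeasure, Measure.smul_apply, Measure.finsetSum_apply, smul_eq_mul,
    Finset.mul_sum, hx2]

theorem isProbabilityMeasure_periodicMeasure {x : FullShift}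
    (hx : x ∈ Function.periodicPts shift) : IsProbabilityMeasure (periodicMeasure x) := by
  have hp0 : 0 < Function.minimalPeriod shift x :=
    Function.minimalPeriod_pos_of_mem_periodicPts hx
  constructor
  rw [periodicMeasure, Measure.smul_apply, Measure.finsetSum_apply]
  simp only [measure_univ, Finset.sum_const, Finset.card_range, nsmul_eq_mul, mul_one, smul_eq_mul]
  exact ENNReal.inv_mul_cancel (by exact_mod_cast hp0.ne') (ENNReal.natCast_ne_top _)

theorem measurePreserving_periodicMeasure (x : FullShift) :
    MeasurePreserving shift (periodicMeasure x) (periodicMeasure x) := by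
  refine ⟨measurable_shift, ?_⟩
  rw [periodicMeasure, Measure.map_smul, ← Measure.mapₗ_apply_of_measurable measurable_shift,
    map_sum]
  congr 1
  simp_rw [Measure.mapₗ_apply_of_measurable measurable_shift, Measure.map_dirac,
    ← Function.iterate_succ_apply' shift]
  -- The sum of Dirac masses over one more than a period can lose its first or its last term; these
  -- two terms coincide.
  have h := Finset.sum_range_succ (fun j => Measure.dirac (shift^[j] x))
    (Function.minimalPeriod shift x)
  rw [Finset.sum_range_succ', Function.iterate_minimalPeriod] at h
  ext S hS
  have h2 := congrArg (fun m : Measure FullShift => m S) h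
  simp only [Measure.add_apply, Function.iterate_zero, id_eq] at h2
  exact (ENNReal.add_left_inj (measure_ne_top _ _)).1 h2

theorem isErgodicMeasureOn_periodicMeasure {x : FullShift}
    (hx : x ∈ Function.periodicPts shift) :
    IsErgodicMeasureOn (orbitClosure x) (periodicMeasure x) := by
  have hP := isProbabilityMeasure_periodicMeasure hx
  have hnull : ∀ S, MeasurableSet S → (∀ j, shift^[j] x ∉ S) → periodicMeasure x S = 0 := by
    intro S hS h
    rw [periodicMeasure, Measure.smul_apply, Measure.finsetSum_apply, Finset.sum_eq_zero,
      smul_zero]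
    intro j _
    rw [Measure.dirac_apply' _ hS, Set.indicator_of_notMem (h j)]
  refine ⟨hP, ⟨measurePreserving_periodicMeasure x, ⟨fun S hS hinv => ?_⟩⟩, ?_⟩
  · have hiff : ∀ j, shift^[j] x ∈ S ↔ x ∈ S := by
      intro j
      induction j with
      | zero => rfl
      | succ j ih => rw [Function.iterate_succ_apply', ← ih, ← Set.mem_preimage, hinv]
    rw [eventuallyConst_set]
    by_cases h : x ∈ S
    · left
      exact mem_ae_iff.2 (hnull _ hS.compl fun j => by simpa using (hiff j).2 h)
    · right
      rw [ae_iff]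
      simpa using hnull _ hS fun j => by rwa [hiff]
  · have hY : MeasurableSet (orbitClosure x) := isClosed_closure.measurableSet
    refine (prob_compl_eq_zero_iff hY).1 (hnull _ hY.compl fun j => ?_)
    rw [Set.mem_compl_iff, not_not]
    exact subset_closure ⟨j, by funext i; rw [shift_iterate_apply]⟩

theorem isErgodicMeasureOn_orbitClosure_iff {x : FullShift}
    (hx : x ∈ Function.periodicPts shift) (μ : Measure FullShift) :
    IsErgodicMeasureOn (orbitClosure x) μ ↔ μ = periodicMeasure x := by
  constructor
  · intro h
    have := h.isProbabilityMeasure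
    exact eq_periodicMeasure hx h.ergodic.toMeasurePreserving h.measure_eq_one
  · rintro rfl
    exact isErgodicMeasureOn_periodicMeasure hx

theorem integral_periodicMeasure {x : FullShift} (f : C(FullShift, ℂ)) :
    ∫ y, f y ∂periodicMeasure x = (1 / (Function.minimalPeriod shift x : ℂ)) *
      ∑ j ∈ Finset.range (Function.minimalPeriod shift x), f (shift^[j] x) := by
  rw [periodicMeasure, integral_smul_measure, integral_finsetSum_measure]
  · simp [integral_dirac, Complex.real_smul]
  · intro j _
    exact integrable_dirac (by simp)

/-! ### Averages of periodic sequences -/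

theorem tendsto_average_of_periodic {𝕜 : Type*} [RCLike 𝕜] {f : ℕ → 𝕜} {p : ℕ}
    (hp : 0 < p) (hf : Function.Periodic f p) :
    Tendsto (fun n : ℕ => (1 / (n : 𝕜)) * ∑ j ∈ Finset.range n, f j) atTop
      (𝓝 ((1 / (p : 𝕜)) * ∑ j ∈ Finset.range p, f j)) := by
  set m := (1 / (p : 𝕜)) * ∑ j ∈ Finset.range p, f j with hm
  -- The centred partial sums vanish over a full period, so they are periodic, hence bounded, and
  -- disappear after division by n.
  set s : ℕ → 𝕜 := fun n => ∑ j ∈ Finset.range n, (f j - m) with hs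
  have hp' : (p : 𝕜) ≠ 0 := by exact_mod_cast hp.ne'
  have hsp : s p = 0 := by
    simp only [hs, Finset.sum_sub_distrib, Finset.sum_const, Finset.card_range, nsmul_eq_mul, hm]
    field_simp
    simp
  have hper : Function.Periodic s p := by
    intro n
    have : s (n + p) = s p + s n := by
      simp only [hs]
      rw [add_comm n p, Finset.sum_range_add]
      congr 1
      exact Finset.sum_congr rfl fun j _ => by rw [add_comm p j, hf j]
    rw [this, hsp, zero_add]
  have hbound : ∀ n, ‖s n‖ ≤ ∑ i ∈ Finset.range p, ‖s i‖ := by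
    intro n
    rw [← hper.map_mod_nat n]
    exact Finset.single_le_sum (f := fun i => ‖s i‖) (fun _ _ => norm_nonneg _)
      (Finset.mem_range.2 (Nat.mod_lt n hp))
  have hlim : Tendsto (fun n : ℕ => (1 / (n : 𝕜)) * s n) atTop (𝓝 0) := by
    have h1 : Tendsto (fun n : ℕ => (1 / (n : ℝ)) * ∑ i ∈ Finset.range p, ‖s i‖) atTop (𝓝 0) := by
      simpa using tendsto_one_div_atTop_nhds_zero_nat.mul_const (∑ i ∈ Finset.range p, ‖s i‖)
    refine squeeze_zero_norm (fun n => ?_) h1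
    rw [norm_mul, norm_div, norm_one, RCLike.norm_natCast]
    exact mul_le_mul_of_nonneg_left (hbound n) (by positivity)
  have h2 : Tendsto (fun n : ℕ => (1 / (n : 𝕜)) * s n + m) atTop (𝓝 m) := by
    simpa using hlim.add_const m
  refine h2.congr' ?_
  filter_upwards [eventually_gt_atTop 0] with n hn
  have hn' : (n : 𝕜) ≠ 0 := by exact_mod_cast hn.ne'
  simp only [hs, Finset.sum_sub_distrib, Finset.sum_const, Finset.card_range, nsmul_eq_mul]
  field_simp
  ring

/-! ### Characteristic sequences of free sets -/

theorem eta_eq_zero_iff {C : Set ℕ} {j : ℤ} : eta C j = 0 ↔ ∃ b ∈ C, (b : ℤ) ∣ j := by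
  unfold eta
  split_ifs with h
  · simpa [freeSet] using h
  · simpa [freeSet] using h

theorem eta_mem_periodicPts {C : Set ℕ} (hC : C.Finite) (h0 : 0 ∉ C) :
    eta C ∈ Function.periodicPts shift := by
  refine ⟨∏ b ∈ hC.toFinset, b, Nat.pos_of_ne_zero ?_, ?_⟩
  · rw [Finset.prod_ne_zero_iff]
    rintro b hb rfl
    exact h0 (by simpa using hb)
  · funext i
    rw [shift_iterate_apply]
    unfold eta
    congr 1
    simp only [freeSet, Set.mem_ofPred_eq, eq_iff_iff]
    refine forall₂_congr fun b hb => not_congr ?_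
    have : (b : ℤ) ∣ ((∏ b ∈ hC.toFinset, b : ℕ) : ℤ) :=
      Int.natCast_dvd_natCast.2 (Finset.dvd_prod_of_mem _ (by simpa using hb))
    exact (dvd_add_left this)

theorem initialPart_subset (B : Set ℕ) (m : ℕ) : initialPart B m ⊆ B := fun _ h => h.1

theorem initialPart_mono (B : Set ℕ) : Monotone (initialPart B) :=
  fun _ _ h _ hb => ⟨hb.1, hb.2.trans_le h⟩

/-- The rank of an element within B is an injective function on B, and here it takes values below m.
-/
theorem finite_initialPart (B : Set ℕ) (m : ℕ) : (initialPart B m).Finite := by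
  refine Set.Finite.of_finite_image (f := fun b => {a ∈ B | a < b}.ncard)
    ((Set.finite_Iio m).subset (Set.image_subset_iff.2 fun b hb => hb.2)) ?_
  have hlt : ∀ a ∈ B, ∀ b, a < b → {c ∈ B | c < a}.ncard < {c ∈ B | c < b}.ncard := by
    intro a ha b hab
    refine Set.ncard_lt_ncard ?_ ((Set.finite_Iio b).subset fun c hc => hc.2)
    exact ⟨fun c hc => ⟨hc.1, hc.2.trans hab⟩, fun h => lt_irrefl a (h ⟨ha, hab⟩).2⟩
  intro a ha b hb hab
  rcases lt_trichotomy a b with h | h | h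
  · exact absurd hab (hlt a ha.1 b h).ne
  · exact h
  · exact absurd hab (hlt b hb.1 a h).ne'

theorem mem_initialPart {B : Set ℕ} {b m : ℕ} (hb : b ∈ B) (hm : b < m) :
    b ∈ initialPart B m := by
  refine ⟨hb, lt_of_le_of_lt ?_ hm⟩
  calc {a ∈ B | a < b}.ncard ≤ (Set.Iio b).ncard :=
        Set.ncard_le_ncard (fun c hc => hc.2) (Set.finite_Iio b)
    _ = b := by rw [Set.ncard_eq_toFinset_card']; simp

/-! ### The universal odometer -/

/-- The closure of the diagonal copy of `ℤ` in the product of all finite cyclic groups. -/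
abbrev Odometer : Type :=
  (AddSubgroup.zmultiples (1 : ∀ n : ℕ+, ZMod n)).topologicalClosure

namespace Odometer

instance : CompactSpace Odometer :=
  isCompact_iff_compactSpace.1 (AddSubgroup.isClosed_topologicalClosure _).isCompact

noncomputable instance : MeasurableSpace Odometer := borel _
instance : SecondCountableTopology Odometer :=
  TopologicalSpace.Subtype.secondCountableTopology _

instance : BorelSpace Odometer := ⟨rfl⟩

/-- The topological generator. -/
def gen : Odometer := ⟨1, AddSubgroup.le_topologicalClosure _ (AddSubgroup.mem_zmultiples _)⟩

/-- The translation by the generator. -/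
noncomputable def rot (g : Odometer) : Odometer := gen + g

/-- The normalised Haar measure. -/
noncomputable def haar : Measure Odometer := Measure.addHaarMeasure ⊤

noncomputable instance : Measure.IsAddHaarMeasure haar := by unfold haar; infer_instance

instance : IsProbabilityMeasure haar :=
  ⟨Measure.addHaarMeasure_self (K₀ := (⊤ : TopologicalSpace.PositiveCompacts Odometer))⟩

theorem denseRange_gen : DenseRange fun k : ℤ => k • gen := by
  intro g
  rw [closure_subtype]
  have h := g.2
  rw [← SetLike.mem_coe, AddSubgroup.topologicalClosure_coe] at h
  refine closure_mono ?_ h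
  rintro _ ⟨k, rfl⟩
  exact ⟨k • gen, ⟨k, rfl⟩, rfl⟩

theorem ergodic_rot : Ergodic rot haar := ergodic_add_left_of_denseRange_zsmul denseRange_gen haar

theorem rot_iterate_val (q : ℕ) (g : Odometer) (n : ℕ+) : (rot^[q] g).1 n = g.1 n + q := by
  induction q with
  | zero => simp
  | succ q ih =>
    rw [Function.iterate_succ_apply']
    change 1 + (rot^[q] g).1 n = _
    rw [ih]; push_cast; ring

theorem continuous_coord (n : ℕ+) : Continuous fun g : Odometer => g.1 n :=
  (continuous_apply n).comp continuous_subtype_val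

theorem isClopen_coord_preimage (n : ℕ+) (s : Set (ZMod n)) :
    IsClopen ((fun g : Odometer => g.1 n) ⁻¹' s) :=
  (isClopen_discrete s).preimage (continuous_coord n)

/-- Finitely many congruences cut out a nonempty open set, which the dense copy of ℤ must meet. -/
theorem exists_int_coord_eq (g : Odometer) {N : ℕ} (hN : 0 < N) :
    ∃ k : ℤ, ∀ n : ℕ+, (n : ℕ) ∣ N → g.1 n = k := by
  obtain ⟨k, hk⟩ : ∃ k : ℤ, (k • gen) ∈ (fun h : Odometer => h.1 ⟨N, hN⟩) ⁻¹' {g.1 ⟨N, hN⟩} ∩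
      {h : Odometer | ∀ n : ℕ+, (n : ℕ) ∣ N → h.1 n = g.1 n} := by
    have hopen : IsOpen ((fun h : Odometer => h.1 ⟨N, hN⟩) ⁻¹' {g.1 ⟨N, hN⟩} ∩
      {h : Odometer | ∀ n : ℕ+, (n : ℕ) ∣ N → h.1 n = g.1 n}) := by
      refine (isClopen_coord_preimage _ _).isOpen.inter ?_
      have hfin : {n : ℕ+ | (n : ℕ) ∣ N}.Finite := by
        refine Set.Finite.of_finite_image (f := fun n : ℕ+ => (n : ℕ)) ?_ PNat.coe_injective.injOn
        refine (Set.finite_Iic N).subset (Set.image_subset_iff.2 fun n hn => Nat.le_of_dvd hN hn)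
      have := hfin.isOpen_biInter fun n _ => (isClopen_coord_preimage n {g.1 n}).isOpen
      convert this using 1
      ext h
      simp
    obtain ⟨k, h1⟩ := denseRange_gen.exists_mem_open hopen ⟨g, rfl, fun _ _ => rfl⟩
    exact ⟨k, h1⟩
  refine ⟨k, fun n hn => ?_⟩
  rw [← hk.2 n hn]
  change k • (1 : ZMod n) = k
  simp

theorem measurableSpace_eq_iSup :
    (inferInstance : MeasurableSpace Odometer) =
      ⨆ n : ℕ+, MeasurableSpace.comap (fun g : Odometer => g.1 n) ⊤ := by
  have h1 : ∀ n : ℕ+, borel (ZMod n) = ⊤ := fun n => borel_eq_top_of_discrete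
  let _ : ∀ n : ℕ+, MeasurableSpace (ZMod n) := fun n => ⊤
  have : ∀ n : ℕ+, BorelSpace (ZMod n) := fun n => ⟨(h1 n).symm⟩
  have h2 : (inferInstance : MeasurableSpace Odometer) =
      MeasurableSpace.comap Subtype.val (MeasurableSpace.pi : MeasurableSpace (∀ n : ℕ+, ZMod n)) := by
    change borel Odometer = _
    rw [BorelSpace.measurable_eq (α := ∀ n : ℕ+, ZMod n), borel_comap]
  rw [h2, MeasurableSpace.pi, MeasurableSpace.comap_iSup]
  simp only [MeasurableSpace.comap_comp]
  rfl

/-- The measurable sets that are invariant under some power of the rotation. -/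
def periodicSets : Set (Set Odometer) :=
  {S | MeasurableSet S ∧ ∃ q : ℕ, 0 < q ∧ ∀ g, rot^[q] g ∈ S ↔ g ∈ S}

theorem rot_iterate_mul_mem_iff {S : Set Odometer} {q : ℕ}
    (h : ∀ g, rot^[q] g ∈ S ↔ g ∈ S) (k : ℕ) (g : Odometer) : rot^[q * k] g ∈ S ↔ g ∈ S := by
  induction k with
  | zero => simp
  | succ k ih => rw [Nat.mul_succ, add_comm, Function.iterate_add_apply, h, ih]

theorem isSetAlgebra_periodicSets : IsSetAlgebra periodicSets where
  empty_mem := ⟨MeasurableSet.empty, 1, one_pos, by simp⟩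
  compl_mem := fun S ⟨hS, q, hq, h⟩ => ⟨hS.compl, q, hq, fun g => by simp [h]⟩
  union_mem := by
    rintro S T ⟨hS, q, hq, h⟩ ⟨hT, r, hr, h'⟩
    refine ⟨hS.union hT, q * r, Nat.mul_pos hq hr, fun g => ?_⟩
    rw [Set.mem_union, Set.mem_union, rot_iterate_mul_mem_iff h, mul_comm q r,
      rot_iterate_mul_mem_iff h']

/-- Cylinders over the n-th coordinate are invariant under the n-th power of the rotation and
together generate the Borel σ-algebra; a generating algebra is dense in measure. -/
theorem measureDense_periodicSets : haar.MeasureDense periodicSets := by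
  refine Measure.MeasureDense.of_generateFrom_isSetAlgebra_finite haar
    isSetAlgebra_periodicSets (le_antisymm ?_ ?_)
  · change (inferInstance : MeasurableSpace Odometer) ≤ _
    rw [measurableSpace_eq_iSup]
    refine iSup_le fun n => ?_
    rintro _ ⟨s, -, rfl⟩
    refine MeasurableSpace.measurableSet_generateFrom
      ⟨(isClopen_coord_preimage n s).isOpen.measurableSet, n, n.pos, fun g => ?_⟩
    rw [Set.mem_preimage, Set.mem_preimage, rot_iterate_val, ZMod.natCast_self, add_zero]
  · exact MeasurableSpace.generateFrom_le fun S hS => hS.1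

end Odometer

/-! ### Sets of multiples: the Davenport–Erdős theorem -/

section Multiples

open ArithmeticFunction

/-- The arithmetic function `n ↦ n ^ (-ε)`. -/
noncomputable def negPow (ε : ℝ) : ArithmeticFunction ℝ :=
  ⟨fun n => if n = 0 then 0 else (n : ℝ) ^ (-ε), if_pos rfl⟩

theorem negPow_apply {ε : ℝ} {n : ℕ} (hn : n ≠ 0) : negPow ε n = (n : ℝ) ^ (-ε) := if_neg hn

theorem negPow_nonneg (ε : ℝ) (n : ℕ) : 0 ≤ negPow ε n := by
  by_cases hn : n = 0
  · simp [hn]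
  · rw [negPow_apply hn]; positivity

theorem negPow_mul (ε : ℝ) (a b : ℕ) : negPow ε (a * b) = negPow ε a * negPow ε b := by
  by_cases ha : a = 0
  · simp [ha]
  by_cases hb : b = 0
  · simp [hb]
  rw [negPow_apply ha, negPow_apply hb, negPow_apply (mul_ne_zero ha hb), Nat.cast_mul,
    Real.mul_rpow (by positivity) (by positivity)]

theorem isMultiplicative_negPow (ε : ℝ) : (negPow ε).IsMultiplicative :=
  ⟨by simp [negPow_apply], fun _ => negPow_mul ε _ _⟩

/-- The Dirichlet convolution inverse of `negPow`. -/
noncomputable def moebiusNegPow (ε : ℝ) : ArithmeticFunction ℝ :=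
  pmul (moebius : ArithmeticFunction ℝ) (negPow ε)

theorem isMultiplicative_moebiusNegPow (ε : ℝ) : (moebiusNegPow ε).IsMultiplicative :=
  isMultiplicative_moebius.intCast.pmul (isMultiplicative_negPow ε)

theorem negPow_mul_moebiusNegPow (ε : ℝ) : negPow ε * moebiusNegPow ε = 1 := by
  ext n
  have h : ∑ x ∈ n.divisorsAntidiagonal, ((moebius : ArithmeticFunction ℝ) x.2) =
      (1 : ArithmeticFunction ℝ) n := by
    rw [← coe_zeta_mul_coe_moebius, mul_apply]
    refine Finset.sum_congr rfl fun x hx => ?_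
    have : x.1 ≠ 0 := Nat.ne_zero_of_mem_divisorsAntidiagonal hx |>.1
    simp [natCoe_apply, zeta_apply, this]
  have h2 : (negPow ε * moebiusNegPow ε) n = negPow ε n * (1 : ArithmeticFunction ℝ) n := by
    rw [← h, mul_apply, Finset.mul_sum]
    refine Finset.sum_congr rfl fun x hx => ?_
    rw [← (Nat.mem_divisorsAntidiagonal.1 hx).1, negPow_mul, moebiusNegPow, pmul_apply]
    ring
  rw [h2]
  by_cases hn : n = 1
  · simp [hn, negPow_apply]
  · simp [one_apply_ne hn]

/-- The quotient of `ζ` by `negPow`. -/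
noncomputable def zetaQuotient (ε : ℝ) : ArithmeticFunction ℝ :=
  moebiusNegPow ε * (zeta : ArithmeticFunction ℝ)

theorem negPow_mul_zetaQuotient (ε : ℝ) :
    negPow ε * zetaQuotient ε = (zeta : ArithmeticFunction ℝ) := by
  rw [zetaQuotient, ← mul_assoc, negPow_mul_moebiusNegPow, one_mul]

/-- By multiplicativity only prime powers matter, and at p^k with k ≥ 1 the value is 1 - p^(-ε). -/
theorem zetaQuotient_nonneg {ε : ℝ} (hε : 0 ≤ ε) (n : ℕ) : 0 ≤ zetaQuotient ε n := by
  by_cases hn : n = 0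
  · simp [hn]
  have hmul : (zetaQuotient ε).IsMultiplicative :=
    (isMultiplicative_moebiusNegPow ε).mul isMultiplicative_zeta.natCast
  rw [hmul.multiplicative_factorization _ hn]
  refine Finset.prod_nonneg fun p hp => ?_
  have hp' : p.Prime := Nat.prime_of_mem_primeFactors (by simpa using hp)
  obtain ⟨k, hk⟩ : ∃ k, n.factorization p = k + 1 :=
    ⟨n.factorization p - 1, by have := Finsupp.mem_support_iff.1 hp; omega⟩
  rw [hk]
  beta_reduce
  rw [zetaQuotient, coe_mul_zeta_apply, Nat.sum_divisors_prime_pow hp',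
    Finset.sum_range_succ', Finset.sum_range_succ']
  have hz : ∑ i ∈ Finset.range k, moebiusNegPow ε (p ^ (i + 1 + 1)) = 0 := by
    refine Finset.sum_eq_zero fun i _ => ?_
    rw [moebiusNegPow, pmul_apply, intCoe_apply, moebius_apply_prime_pow hp' (by omega)]
    simp
  have h1 : (p : ℝ) ^ (-ε) ≤ 1 :=
    Real.rpow_le_one_of_one_le_of_nonpos (by exact_mod_cast hp'.one_lt.le) (by linarith)
  rw [hz]
  simp [moebiusNegPow, pmul_apply, moebius_apply_prime hp', negPow_apply, hp'.ne_zero, h1]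

/-- The case a = 0 is included, both sides being 0 by the convention on division, so that series
over all of ℕ can use it. -/
theorem tendsto_nat_div_div (a : ℕ) :
    Tendsto (fun y : ℕ => ((y / a : ℕ) : ℝ) / y) atTop (𝓝 (1 / (a : ℝ))) := by
  have h := (tendsto_nat_floor_mul_div_atTop (R := ℝ) (a := 1 / (a : ℝ)) (by positivity)).comp
    tendsto_natCast_atTop_atTop
  refine h.congr fun y => ?_
  simp only [Function.comp_apply]
  rw [one_div_mul_eq_div, Nat.floor_div_eq_div]

theorem summable_negPow_div {ε : ℝ} (hε : 0 < ε) : Summable fun n : ℕ => (n : ℝ) ^ (-(1 + ε)) := by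
  rw [Real.summable_nat_rpow]; linarith

theorem rpow_neg_one_add {ε : ℝ} (n : ℕ) : (n : ℝ) ^ (-(1 + ε)) ≥ 0 := by positivity

theorem negPow_div_eq {ε : ℝ} (hε : 0 < ε) (n : ℕ) :
    negPow ε n / n = (n : ℝ) ^ (-(1 + ε)) := by
  by_cases hn : n = 0
  · subst hn
    rw [Nat.cast_zero, Real.zero_rpow (by linarith)]; simp
  · have : (0 : ℝ) < n := by positivity
    rw [negPow_apply hn, show -(1 + ε) = -ε - 1 by ring, Real.rpow_sub_one this.ne']

theorem norm_moebiusNegPow_le (ε : ℝ) (n : ℕ) : ‖moebiusNegPow ε n‖ ≤ negPow ε n := by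
  rw [moebiusNegPow, pmul_apply, norm_mul, Real.norm_of_nonneg (negPow_nonneg ε n)]
  refine mul_le_of_le_one_left (negPow_nonneg ε n) ?_
  rw [intCoe_apply, Real.norm_eq_abs]
  exact_mod_cast abs_moebius_le_one

/-- The sum up to y equals ∑ μ(a) a^(-ε) ⌊y/a⌋, and after division by y its terms are dominated by
a^(-1-ε). The limit, the mean value of `zetaQuotient`, is 1/ζ(1+ε) by `tsum_moebiusNegPow_mul_tsum`.
-/
theorem tendsto_sum_zetaQuotient_div {ε : ℝ} (hε : 0 < ε) :
    Tendsto (fun y : ℕ => (∑ e ∈ Finset.Ioc 0 y, zetaQuotient ε e) / y) atTop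
      (𝓝 (∑' a : ℕ, moebiusNegPow ε a / a)) := by
  have h : Tendsto (fun y : ℕ => ∑' a : ℕ, moebiusNegPow ε a * (((y / a : ℕ) : ℝ) / y)) atTop
      (𝓝 (∑' a : ℕ, moebiusNegPow ε a * (1 / (a : ℝ)))) := by
    refine tendsto_tsum_of_dominated_convergence (summable_negPow_div hε)
      (fun a => (tendsto_nat_div_div a).const_mul _) ?_
    filter_upwards [eventually_gt_atTop 0] with y hy a
    rw [norm_mul, ← negPow_div_eq hε, div_eq_mul_one_div (negPow ε a)]
    refine mul_le_mul (norm_moebiusNegPow_le ε a) ?_ (norm_nonneg _) (negPow_nonneg ε a)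
    rw [Real.norm_of_nonneg (by positivity), div_le_iff₀ (by exact_mod_cast hy),
      one_div_mul_eq_div]
    exact Nat.cast_div_le
  simp only [mul_one_div] at h
  refine h.congr fun y => ?_
  rw [zetaQuotient, sum_Ioc_mul_zeta_eq_sum, Finset.sum_div, tsum_eq_sum (s := Finset.Ioc 0 y)]
  · exact Finset.sum_congr rfl fun a _ => by ring
  · intro a ha
    rcases Nat.eq_zero_or_pos a with rfl | h0
    · simp
    · have : y < a := by simpa [h0] using ha
      simp [Nat.div_eq_of_lt this]

theorem tsum_moebiusNegPow_mul_tsum {ε : ℝ} (hε : 0 < ε) :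
    (∑' n : ℕ, (n : ℝ) ^ (-(1 + ε))) * ∑' a : ℕ, moebiusNegPow ε a / a = 1 := by
  have h := LSeries_zeta_mul_Lseries_moebius (s := ((1 + ε : ℝ) : ℂ)) (by simpa using hε)
  have hc : ∀ n : ℕ, n ≠ 0 → (((n : ℝ) ^ (-(1 + ε)) : ℝ) : ℂ) = 1 / (n : ℂ) ^ ((1 + ε : ℝ) : ℂ) := by
    intro n _
    rw [Complex.ofReal_cpow (by positivity)]
    push_cast
    rw [Complex.cpow_neg, one_div]
  have h1 : LSeries (fun n => ((zeta n : ℕ) : ℂ)) ((1 + ε : ℝ) : ℂ) =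
      ((∑' n : ℕ, (n : ℝ) ^ (-(1 + ε)) : ℝ) : ℂ) := by
    rw [Complex.ofReal_tsum, LSeries]
    refine tsum_congr fun n => ?_
    rcases eq_or_ne n 0 with rfl | hn
    · rw [LSeries.term_zero, Nat.cast_zero, Real.zero_rpow (by linarith)]; simp
    · rw [LSeries.term_of_ne_zero hn, hc n hn, zeta_apply, if_neg hn, Nat.cast_one]
  have h2 : LSeries (fun n => ((moebius n : ℤ) : ℂ)) ((1 + ε : ℝ) : ℂ) =
      ((∑' a : ℕ, moebiusNegPow ε a / a : ℝ) : ℂ) := by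
    rw [Complex.ofReal_tsum, LSeries]
    refine tsum_congr fun n => ?_
    rcases eq_or_ne n 0 with rfl | hn
    · simp
    · rw [LSeries.term_of_ne_zero hn, moebiusNegPow, pmul_apply, mul_div_assoc,
        negPow_div_eq hε, Complex.ofReal_mul, hc n hn, intCoe_apply]
      push_cast
      ring
  rw [h1, h2] at h
  exact_mod_cast h

/-! ### Counting in sets closed under multiples -/

open Classical in
/-- The number of positive integers up to `x` in the set `M`. -/
noncomputable def countIn (M : Set ℕ) (x : ℕ) : ℕ := ((Finset.Ioc 0 x).filter (· ∈ M)).card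

theorem sum_indicator_Ioc (M : Set ℕ) (x : ℕ) :
    ∑ n ∈ Finset.Ioc 0 x, M.indicator (1 : ℕ → ℝ) n = countIn M x := by
  classical
  simp [countIn, Set.indicator_apply, Finset.sum_boole]

/-- For each n the weights d^(-ε) `zetaQuotient`(n/d) over d ∣ n are nonnegative with sum 1.
Restricting to d ∈ M keeps at most 1 if n ∈ M, and nothing otherwise, since M is closed under
multiples. -/
theorem sum_mul_sum_zetaQuotient_le {M : Set ℕ} (hM : ∀ n ∈ M, ∀ k, n * k ∈ M) {ε : ℝ}
    (hε : 0 < ε) (x : ℕ) :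
    ∑ d ∈ Finset.Ioc 0 x, M.indicator (negPow ε) d * ∑ e ∈ Finset.Ioc 0 (x / d), zetaQuotient ε e
      ≤ countIn M x := by
  let F : ArithmeticFunction ℝ := ⟨M.indicator (negPow ε), by simp⟩
  have hF : ∀ n, F n = M.indicator (negPow ε) n := fun n => rfl
  calc _ = ∑ n ∈ Finset.Ioc 0 x, (F * zetaQuotient ε) n := by
        rw [sum_Ioc_mul_eq_sum_sum]; rfl
    _ ≤ ∑ n ∈ Finset.Ioc 0 x, M.indicator (1 : ℕ → ℝ) n := by
        refine Finset.sum_le_sum fun n hn => ?_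
        have hn0 : n ≠ 0 := by have := Finset.mem_Ioc.1 hn; omega
        rw [mul_apply]
        by_cases hnM : n ∈ M
        · have h1 : (negPow ε * zetaQuotient ε) n = 1 := by
            rw [negPow_mul_zetaQuotient, natCoe_apply, zeta_apply, if_neg hn0, Nat.cast_one]
          rw [Set.indicator_of_mem hnM, Pi.one_apply, ← h1, mul_apply]
          refine Finset.sum_le_sum fun y _ => ?_
          refine mul_le_mul_of_nonneg_right ?_ (zetaQuotient_nonneg hε.le _)
          exact Set.indicator_le_self' (fun _ _ => negPow_nonneg ε _) _
        · rw [Set.indicator_of_notMem hnM]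
          refine (Finset.sum_eq_zero fun y hy => ?_).le
          have hy1 : y.1 ∉ M := fun h =>
            hnM ((Nat.mem_divisorsAntidiagonal.1 hy).1 ▸ hM _ h y.2)
          rw [hF, Set.indicator_of_notMem hy1, zero_mul]
    _ = countIn M x := sum_indicator_Ioc M x

/-- Keep only d ≤ D in the previous inequality, divide by x and let x → ∞: each d ∈ M contributes
d^(-1-ε)/ζ(1+ε) on the left, and the right side tends to α. -/
theorem sum_rpow_le_of_tendsto_countIn {M : Set ℕ} (hM : ∀ n ∈ M, ∀ k, n * k ∈ M) {α : ℝ}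
    (hα : Tendsto (fun x : ℕ => (countIn M x : ℝ) / x) atTop (𝓝 α)) {ε : ℝ} (hε : 0 < ε) (D : ℕ) :
    ∑ n ∈ Finset.Ioc 0 D, M.indicator (fun n : ℕ => (n : ℝ) ^ (-(1 + ε))) n ≤
      α * ∑' n : ℕ, (n : ℝ) ^ (-(1 + ε)) := by
  set c := ∑' a : ℕ, moebiusNegPow ε a / a with hc
  set Z := ∑' n : ℕ, (n : ℝ) ^ (-(1 + ε)) with hZ
  have hZ0 : 0 ≤ Z := tsum_nonneg fun n => rpow_neg_one_add n
  have hG : ∀ d ∈ Finset.Ioc 0 D, Tendsto (fun x : ℕ => M.indicator (negPow ε) d *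
      ((∑ e ∈ Finset.Ioc 0 (x / d), zetaQuotient ε e) / x)) atTop
      (𝓝 (M.indicator (negPow ε) d * (c * (1 / (d : ℝ))))) := by
    intro d hd
    have hd0 : 0 < d := (Finset.mem_Ioc.1 hd).1
    refine Tendsto.const_mul _ ?_
    have h1 := ((tendsto_sum_zetaQuotient_div hε).comp
      (Nat.tendsto_div_const_atTop hd0.ne')).mul (tendsto_nat_div_div d)
    refine h1.congr' ?_
    filter_upwards [eventually_ge_atTop d] with x hx
    have : ((x / d : ℕ) : ℝ) ≠ 0 := by
      exact_mod_cast (Nat.div_pos hx hd0).ne'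
    simp only [Function.comp_apply]
    rw [div_mul_div_cancel₀ this]
  have h := le_of_tendsto_of_tendsto (tendsto_finsetSum _ hG) hα ?_
  · have hsum : ∑ d ∈ Finset.Ioc 0 D, M.indicator (negPow ε) d * (c * (1 / (d : ℝ))) =
        c * ∑ n ∈ Finset.Ioc 0 D, M.indicator (fun n : ℕ => (n : ℝ) ^ (-(1 + ε))) n := by
      rw [Finset.mul_sum]
      refine Finset.sum_congr rfl fun d _ => ?_
      by_cases hdM : d ∈ M
      · rw [Set.indicator_of_mem hdM, Set.indicator_of_mem hdM, ← negPow_div_eq hε]; ring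
      · rw [Set.indicator_of_notMem hdM, Set.indicator_of_notMem hdM]; ring
    rw [hsum] at h
    have h2 := mul_le_mul_of_nonneg_left h hZ0
    rwa [← mul_assoc, tsum_moebiusNegPow_mul_tsum hε, one_mul, mul_comm Z α] at h2
  · filter_upwards [eventually_ge_atTop D] with x hx
    rw [← Finset.sum_congr rfl fun d _ => mul_div_assoc _ _ _, ← Finset.sum_div]
    refine div_le_div_of_nonneg_right (le_trans ?_ (sum_mul_sum_zetaQuotient_le hM hε x))
      (by positivity)
    refine Finset.sum_le_sum_of_subset_of_nonneg (Finset.Ioc_subset_Ioc_right hx) fun d _ _ => ?_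
    exact mul_nonneg (Set.indicator_nonneg (fun _ _ => negPow_nonneg ε _) _)
      (Finset.sum_nonneg fun e _ => zetaQuotient_nonneg hε.le e)

/-- A one-sided form of summation by parts. -/
theorem neg_mul_le_sum_mul_of_sum_ge {a w : ℕ → ℝ} {K : ℝ}
    (hS : ∀ x, -K ≤ ∑ n ∈ Finset.Ioc 0 x, a n) (hw : ∀ n, 0 < n → w (n + 1) ≤ w n)
    (hw0 : ∀ n, 0 ≤ w n) {D : ℕ} (hD : 1 ≤ D) :
    -(K * w 1) ≤ ∑ n ∈ Finset.Ioc 0 D, a n * w n := by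
  -- The boundary term of the summation by parts is kept in the induction hypothesis; it is
  -- nonnegative and is dropped at the end.
  have key : (∑ n ∈ Finset.Ioc 0 D, a n + K) * w D - K * w 1 ≤
      ∑ n ∈ Finset.Ioc 0 D, a n * w n := by
    induction D, hD using Nat.le_induction with
    | base => simp; linarith
    | succ D hD ih =>
      rw [Finset.sum_Ioc_succ_top (Nat.zero_le D), Finset.sum_Ioc_succ_top (Nat.zero_le D)]
      have := mul_le_mul_of_nonneg_left (hw D hD)
        (by linarith [hS D] : 0 ≤ ∑ n ∈ Finset.Ioc 0 D, a n + K)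
      nlinarith
  have := mul_nonneg (by linarith [hS D] : 0 ≤ ∑ n ∈ Finset.Ioc 0 D, a n + K) (hw0 D)
  linarith

/-- If the count were eventually at least δx, summation by parts would give (δ - α) ζ(1+ε) ≤ δ x₀
for every ε > 0, while ζ(1+ε) is unbounded as ε → 0. -/
theorem frequently_countIn_lt {M : Set ℕ} {α δ : ℝ} (hα : 0 ≤ α) (hδ : α < δ)
    (hM : ∀ ε : ℝ, 0 < ε → ∀ D, ∑ n ∈ Finset.Ioc 0 D, M.indicator (fun n : ℕ => (n : ℝ) ^ (-(1 + ε))) n ≤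
      α * ∑' n : ℕ, (n : ℝ) ^ (-(1 + ε))) :
    ∃ᶠ x : ℕ in atTop, (countIn M x : ℝ) < δ * x := by
  by_contra hcon
  rw [not_frequently] at hcon
  obtain ⟨x₀, hx₀⟩ := eventually_atTop.1 hcon
  have hδ0 : 0 < δ := hα.trans_lt hδ
  have hS : ∀ x, -(δ * x₀) ≤ ∑ n ∈ Finset.Ioc 0 x, (M.indicator (1 : ℕ → ℝ) n - δ) := by
    intro x
    rw [Finset.sum_sub_distrib, sum_indicator_Ioc, Finset.sum_const, Nat.card_Ioc, nsmul_eq_mul,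
      Nat.sub_zero]
    rcases le_total x₀ x with h | h
    · have := not_lt.1 (hx₀ x h)
      have : (0 : ℝ) ≤ δ * x₀ := by positivity
      linarith
    · have : (x : ℝ) ≤ x₀ := by exact_mod_cast h
      have h2 : (0 : ℝ) ≤ countIn M x := by positivity
      nlinarith
  have hZ : ∀ ε : ℝ, 0 < ε → (δ - α) * ∑' n : ℕ, (n : ℝ) ^ (-(1 + ε)) ≤ δ * x₀ := by
    intro ε hε
    have hlim : Tendsto (fun D : ℕ => δ * ∑ n ∈ Finset.Ioc 0 D, (n : ℝ) ^ (-(1 + ε))) atTop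
        (𝓝 (δ * ∑' n : ℕ, (n : ℝ) ^ (-(1 + ε)))) := by
      refine Tendsto.const_mul _ ?_
      have := (summable_negPow_div hε).hasSum.tendsto_sum_nat.comp (tendsto_add_atTop_nat 1)
      refine this.congr fun D => ?_
      simp only [Function.comp_apply]
      rw [Finset.sum_range_succ', Nat.cast_zero, Real.zero_rpow (by linarith), add_zero,
        Finset.range_eq_Ico, Finset.sum_Ico_add' (fun n : ℕ => (n : ℝ) ^ (-(1 + ε))) 0 D 1]
      rfl
    have hle : δ * ∑' n : ℕ, (n : ℝ) ^ (-(1 + ε)) ≤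
        α * ∑' n : ℕ, (n : ℝ) ^ (-(1 + ε)) + δ * x₀ := by
      refine le_of_tendsto hlim ?_
      filter_upwards [eventually_ge_atTop 1] with D hD
      have h1 := neg_mul_le_sum_mul_of_sum_ge (w := fun n : ℕ => (n : ℝ) ^ (-(1 + ε))) hS
        (fun n hn => Real.rpow_le_rpow_of_nonpos (by exact_mod_cast hn) (by simp) (by linarith))
        (fun n => rpow_neg_one_add n) hD
      have h2 := hM ε hε D
      have h3 : ∀ n : ℕ, (M.indicator (1 : ℕ → ℝ) n - δ) * (n : ℝ) ^ (-(1 + ε)) =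
          M.indicator (fun n : ℕ => (n : ℝ) ^ (-(1 + ε))) n - δ * (n : ℝ) ^ (-(1 + ε)) := by
        intro n
        by_cases hn : n ∈ M
        · simp [hn]; ring
        · simp [hn]
      simp only [h3, Finset.sum_sub_distrib, ← Finset.mul_sum, Nat.cast_one, Real.one_rpow,
        mul_one] at h1
      linarith
    linarith
  -- Letting ε → 0 in finite partial sums of ζ(1+ε) bounds all partial sums of the harmonic series.
  have hH : ∀ T : ℕ, ∑ n ∈ Finset.range T, (n : ℝ)⁻¹ ≤ δ * x₀ / (δ - α) := by
    intro T
    have hlim : Tendsto (fun ε : ℝ => ∑ n ∈ Finset.range T, (n : ℝ) ^ (-(1 + ε))) (𝓝[>] 0)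
        (𝓝 (∑ n ∈ Finset.range T, (n : ℝ)⁻¹)) := by
      refine tendsto_finsetSum _ fun n _ => ?_
      rcases Nat.eq_zero_or_pos n with rfl | hn
      · refine tendsto_const_nhds.congr' ?_
        filter_upwards [self_mem_nhdsWithin] with ε (hε : 0 < ε)
        rw [Nat.cast_zero, Real.zero_rpow (by linarith), inv_zero]
      · have hcont : Continuous fun ε : ℝ => (n : ℝ) ^ (-(1 + ε)) :=
          Continuous.rpow continuous_const (by fun_prop) fun _ => Or.inl (by positivity)
        have := hcont.tendsto 0
        rw [add_zero, Real.rpow_neg_one] at this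
        exact this.mono_left nhdsWithin_le_nhds
    refine le_of_tendsto hlim ?_
    filter_upwards [self_mem_nhdsWithin] with ε (hε : 0 < ε)
    rw [le_div_iff₀ (by linarith), mul_comm]
    refine le_trans ?_ (hZ ε hε)
    exact mul_le_mul_of_nonneg_left
      ((summable_negPow_div hε).sum_le_tsum _ fun n _ => rpow_neg_one_add n) (by linarith)
  exact Real.not_summable_natCast_inv
    (summable_of_sum_range_le (fun n => by positivity) hH)

end Multiples

/-! ### The coding map and the Mirsky measure -/

open Odometer

open Classical in
/-- The coding of the odometer: the `i`-th coordinate of `code C g` is `1` if and only if `g + i` is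
divisible by no element of `C`. -/
noncomputable def code (C : Set ℕ) (g : Odometer) : FullShift :=
  fun i => if ∀ b : ℕ+, (b : ℕ) ∈ C → g.1 b + (i : ZMod b) ≠ 0 then 1 else 0

theorem code_apply_eq_zero_iff {C : Set ℕ} {g : Odometer} {i : ℤ} :
    code C g i = 0 ↔ ∃ b : ℕ+, (b : ℕ) ∈ C ∧ g.1 b + (i : ZMod b) = 0 := by
  unfold code
  split_ifs with h
  · simpa using h
  · simpa using h

theorem fin_two_eq_of_zero_iff {a b : Fin 2} (h : a = 0 ↔ b = 0) : a = b := by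
  revert a b; decide

theorem measurable_code (C : Set ℕ) : Measurable (code C) := by
  refine measurable_pi_lambda _ fun i => ?_
  refine Measurable.ite ?_ measurable_const measurable_const
  have : {g : Odometer | ∀ b : ℕ+, (b : ℕ) ∈ C → g.1 b + (i : ZMod b) ≠ 0} =
      ⋂ (b : ℕ+) (_ : (b : ℕ) ∈ C), (fun g : Odometer => g.1 b) ⁻¹' {r | r + (i : ZMod b) ≠ 0} := by
    ext g; simp
  rw [this]
  exact MeasurableSet.iInter fun b => MeasurableSet.iInter fun _ =>
    (isClopen_coord_preimage b _).isOpen.measurableSet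

theorem code_rot (C : Set ℕ) (g : Odometer) : code C (rot g) = shift (code C g) := by
  funext i
  refine fin_two_eq_of_zero_iff ?_
  rw [shift, code_apply_eq_zero_iff, code_apply_eq_zero_iff]
  refine exists_congr fun b => and_congr_right fun _ => ?_
  have : (rot g).1 b = 1 + g.1 b := rfl
  rw [this]
  push_cast
  rw [show 1 + g.1 b + (i : ZMod b) = g.1 b + (i + 1) by ring]

theorem semiconj_code (C : Set ℕ) : Function.Semiconj (code C) rot shift := code_rot C

/-- An integer k congruent to g modulo the product of C has the same residues modulo every element
of C, so the code is the translate of `eta C` by k. Excluding 0 matters: `code` only sees positive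
divisors, whereas `eta` also sees 0. -/
theorem code_mem_orbitClosure {C : Set ℕ} (hC : C.Finite) (h0 : 0 ∉ C) (g : Odometer) :
    code C g ∈ orbitClosure (eta C) := by
  have hN : 0 < ∏ b ∈ hC.toFinset, b := by
    refine Finset.prod_pos fun b hb => Nat.pos_of_ne_zero ?_
    rintro rfl
    exact h0 (by simpa using hb)
  obtain ⟨k, hk⟩ := exists_int_coord_eq g hN
  refine subset_closure ⟨k, ?_⟩
  funext i
  refine fin_two_eq_of_zero_iff ?_
  rw [eta_eq_zero_iff, code_apply_eq_zero_iff]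
  have key : ∀ b : ℕ+, (b : ℕ) ∈ C → (g.1 b + (i : ZMod b) = 0 ↔ ((b : ℕ) : ℤ) ∣ i + k) := by
    intro b hb
    rw [hk b (Finset.dvd_prod_of_mem _ (by simpa using hb)), ← ZMod.intCast_zmod_eq_zero_iff_dvd]
    push_cast
    rw [add_comm]
  constructor
  · rintro ⟨b, hb, h⟩
    exact ⟨⟨b, Nat.pos_of_ne_zero fun h => h0 (h ▸ hb)⟩, hb, (key ⟨b, _⟩ hb).2 h⟩
  · rintro ⟨b, hb, h⟩
    exact ⟨b, hb, (key b hb).1 h⟩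

/-- The Mirsky measure. -/
noncomputable def mirsky (C : Set ℕ) : Measure FullShift := haar.map (code C)

instance (C : Set ℕ) : IsProbabilityMeasure (mirsky C) :=
  Measure.isProbabilityMeasure_map (measurable_code C).aemeasurable

theorem measurePreserving_code (C : Set ℕ) : MeasurePreserving (code C) haar (mirsky C) :=
  ⟨measurable_code C, rfl⟩

theorem ergodic_mirsky (C : Set ℕ) : Ergodic shift (mirsky C) :=
  (measurePreserving_code C).ergodic_of_ergodic_semiconj ergodic_rot measurable_shift
    (semiconj_code C)

theorem mirsky_eq_periodicMeasure {C : Set ℕ} (hC : C.Finite) (h0 : 0 ∉ C) :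
    mirsky C = periodicMeasure (eta C) := by
  refine eq_periodicMeasure (eta_mem_periodicPts hC h0) (ergodic_mirsky C).toMeasurePreserving ?_
  have hY : MeasurableSet (orbitClosure (eta C)) := isClosed_closure.measurableSet
  rw [mirsky, Measure.map_apply (measurable_code C) hY,
    Set.eq_univ_of_forall (s := code C ⁻¹' orbitClosure (eta C))
      (fun g => code_mem_orbitClosure hC h0 g), measure_univ]

theorem eventually_code_initialPart_apply (B : Set ℕ) (g : Odometer) (i : ℤ) :
    ∀ᶠ m in atTop, code (initialPart B m) g i = code B g i := by
  by_cases h : code B g i = 0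
  · obtain ⟨b, hb, hbi⟩ := code_apply_eq_zero_iff.1 h
    filter_upwards [eventually_gt_atTop (b : ℕ)] with m hm
    rw [h]
    exact code_apply_eq_zero_iff.2 ⟨b, mem_initialPart hb hm, hbi⟩
  · refine Eventually.of_forall fun m => fin_two_eq_of_zero_iff ?_
    refine iff_of_false (fun h' => ?_) h
    obtain ⟨b, hb, hbi⟩ := code_apply_eq_zero_iff.1 h'
    exact h (code_apply_eq_zero_iff.2 ⟨b, initialPart_subset B m hb, hbi⟩)

theorem tendsto_code_initialPart (B : Set ℕ) (g : Odometer) :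
    Tendsto (fun m => code (initialPart B m) g) atTop (𝓝 (code B g)) :=
  tendsto_pi_nhds.2 fun i => tendsto_nhds_of_eventually_eq (eventually_code_initialPart_apply B g i)

theorem tendsto_integral_mirsky (B : Set ℕ) (f : C(FullShift, ℂ)) :
    Tendsto (fun m => ∫ y, f y ∂mirsky (initialPart B m)) atTop (𝓝 (∫ y, f y ∂mirsky B)) := by
  have h : ∀ C, ∫ y, f y ∂mirsky C = ∫ g, f (code C g) ∂haar := fun C =>
    integral_map (measurable_code C).aemeasurable f.continuous.aestronglyMeasurable
  simp only [h]
  refine tendsto_integral_of_dominated_convergence (fun _ => ‖f‖)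
    (fun m => (f.continuous.measurable.comp (measurable_code _)).aestronglyMeasurable)
    (integrable_const _) (fun m => ae_of_all _ fun g => f.norm_coe_le_norm _)
    (ae_of_all _ fun g => (f.continuous.tendsto _).comp (tendsto_code_initialPart B g))

theorem measurable_dZero : Measurable dZero := by
  refine Measurable.ite ?_ measurable_const measurable_const
  have : Measurable fun p : FullShift × FullShift => (p.1 0, p.2 0) := by fun_prop
  exact this (MeasurableSet.of_discrete (s := {q : Fin 2 × Fin 2 | q.1 ≠ q.2}))

theorem map_prodMk_code_mem_joinings (C D : Set ℕ) :
    haar.map (fun g => (code C g, code D g)) ∈ joinings shift shift (mirsky C) (mirsky D) := by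
  have hm : Measurable fun g => (code C g, code D g) := (measurable_code C).prodMk (measurable_code D)
  refine ⟨?_, ?_, ?_⟩
  · refine MeasurePreserving.of_semiconj (f := fun g => (code C g, code D g)) ⟨hm, rfl⟩
      ergodic_rot.toMeasurePreserving ?_ (measurable_shift.prodMap measurable_shift)
    intro g
    simp [code_rot]
  · rw [Measure.map_map measurable_fst hm]; rfl
  · rw [Measure.map_map measurable_snd hm]; rfl

theorem tendsto_ornsteinDist_mirsky (B : Set ℕ) :
    Tendsto (fun m => ornsteinDist (mirsky (initialPart B m)) (mirsky B)) atTop (𝓝 0) := by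
  have h : Tendsto (fun m => ∫⁻ g, dZero (code (initialPart B m) g, code B g) ∂haar) atTop
      (𝓝 (∫⁻ _, 0 ∂haar)) := by
    refine tendsto_lintegral_of_dominated_convergence (fun _ => 1)
      (fun m => measurable_dZero.comp ((measurable_code _).prodMk (measurable_code _)))
      (fun m => ae_of_all _ fun g => ?_) (by simp) (ae_of_all _ fun g => ?_)
    · simp only [dZero]; split_ifs <;> simp
    · refine tendsto_nhds_of_eventually_eq ?_
      filter_upwards [eventually_code_initialPart_apply B g 0] with m hm
      simp [dZero, hm]
  rw [lintegral_zero] at h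
  refine tendsto_of_tendsto_of_tendsto_of_le_of_le tendsto_const_nhds h (fun _ => zero_le) ?_
  intro m
  refine (iInf₂_le _ (map_prodMk_code_mem_joinings (initialPart B m) B)).trans_eq ?_
  exact lintegral_map measurable_dZero ((measurable_code _).prodMk (measurable_code _))

/-! ### Existence of Davenport–Erdős sequences -/

/-- The nonnegative integers that are divisible by an element of `C`. -/
def multiples (C : Set ℕ) : Set ℕ := {n | ∃ b ∈ C, b ∣ n}

theorem mul_mem_multiples {C : Set ℕ} : ∀ n ∈ multiples C, ∀ k, n * k ∈ multiples C :=
  fun _ ⟨b, hb, h⟩ k => ⟨b, hb, h.mul_right k⟩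

theorem multiples_mono {C D : Set ℕ} (h : C ⊆ D) : multiples C ⊆ multiples D :=
  fun _ ⟨b, hb, hn⟩ => ⟨b, h hb, hn⟩

theorem countIn_mono {M N : Set ℕ} (h : M ⊆ N) (x : ℕ) : countIn M x ≤ countIn N x := by
  classical
  exact Finset.card_le_card (Finset.monotone_filter_right _ fun _ _ hn => h hn)

theorem countIn_le (M : Set ℕ) (x : ℕ) : countIn M x ≤ x := by
  classical
  exact (Finset.card_filter_le _ _).trans (by simp)

theorem eta_natCast_eq_zero_iff {C : Set ℕ} {n : ℕ} : eta C n = 0 ↔ n ∈ multiples C := by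
  rw [eta_eq_zero_iff]
  simp only [Int.natCast_dvd_natCast]
  rfl

theorem exists_tendsto_countIn_multiples {C : Set ℕ} (hC : C.Finite) (h0 : 0 ∉ C) :
    ∃ α : ℝ, Tendsto (fun x : ℕ => (countIn (multiples C) x : ℝ) / x) atTop (𝓝 α) := by
  obtain ⟨p, hp, hper⟩ := eta_mem_periodicPts hC h0
  have hf : Function.Periodic (fun j => (multiples C).indicator (1 : ℕ → ℝ) (j + 1)) p := by
    intro j
    have h1 : (j + p + 1 ∈ multiples C) ↔ (j + 1 ∈ multiples C) := by
      rw [← eta_natCast_eq_zero_iff, ← eta_natCast_eq_zero_iff]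
      have := congrFun hper ((j + 1 : ℕ) : ℤ)
      rw [shift_iterate_apply] at this
      rw [← this]
      push_cast
      rw [show (j : ℤ) + p + 1 = j + 1 + p by ring]
    classical
    simp only [Set.indicator_apply, h1, Pi.one_apply]
  refine ⟨_, (tendsto_average_of_periodic (𝕜 := ℝ) hp hf).congr fun x => ?_⟩
  rw [← sum_indicator_Ioc, Finset.range_eq_Ico,
    Finset.sum_Ico_add' (fun n : ℕ => (multiples C).indicator (1 : ℕ → ℝ) n) 0 x 1, one_div,
    inv_mul_eq_div]
  rfl

/-- Off position 0 the sequences differ only at multiples of D that are not multiples of C. The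
extra 1 pays for position 0, which `countIn` leaves out. -/
theorem card_filter_eta_ne_le {C D : Set ℕ} (h : C ⊆ D) (n : ℕ) :
    (((Finset.range n).filter fun j : ℕ => eta C j ≠ eta D j).card : ℝ) ≤
      1 + (countIn (multiples D) n - countIn (multiples C) n) := by
  classical
  have h1 : ((Finset.range n).filter fun j : ℕ => eta C j ≠ eta D j) ⊆
      insert 0 ((Finset.Ioc 0 n).filter (· ∈ multiples D) \
        (Finset.Ioc 0 n).filter (· ∈ multiples C)) := by
    intro j hj
    rw [Finset.mem_filter, Finset.mem_range] at hj
    rw [Finset.mem_insert, Finset.mem_sdiff, Finset.mem_filter, Finset.mem_filter, Finset.mem_Ioc]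
    by_cases hj0 : j = 0
    · exact Or.inl hj0
    have h2 : ¬ (j ∈ multiples C ↔ j ∈ multiples D) := fun h => hj.2 <| fin_two_eq_of_zero_iff <| by
      rwa [eta_natCast_eq_zero_iff, eta_natCast_eq_zero_iff]
    have h3 := @multiples_mono C D h j
    right
    refine ⟨⟨by omega, by tauto⟩, by tauto⟩
  have h2 : (Finset.Ioc 0 n).filter (· ∈ multiples C) ⊆
      (Finset.Ioc 0 n).filter (· ∈ multiples D) :=
    Finset.monotone_filter_right _ fun j _ hj => multiples_mono h hj
  have h3 := (Finset.card_le_card h1).trans (Finset.card_insert_le _ _)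
  rw [Finset.card_sdiff_of_subset h2] at h3
  have h4 := Finset.card_le_card h2
  have h5 : countIn (multiples D) n = ((Finset.Ioc 0 n).filter (· ∈ multiples D)).card := by
    unfold countIn; congr!
  have h6 : countIn (multiples C) n = ((Finset.Ioc 0 n).filter (· ∈ multiples C)).card := by
    unfold countIn; congr!
  rw [h5, h6]
  refine (Nat.cast_le.2 h3).trans_eq ?_
  rw [Nat.cast_add, Nat.cast_sub h4, Nat.cast_one, add_comm]

theorem average_card_mem_Icc (n : ℕ) (x y : FullShift) :
    (1 / (n : ℝ)) * (((Finset.range n).filter fun j : ℕ => x j ≠ y j).card : ℝ) ∈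
      Set.Icc (0 : ℝ) 1 := by
  refine ⟨by positivity, ?_⟩
  rw [one_div_mul_eq_div]
  refine div_le_one_of_le₀ ?_ (by positivity)
  exact_mod_cast (Finset.card_filter_le _ _).trans (by simp)

theorem isBoundedUnder_average (n : ℕ → ℕ) (x y : FullShift) :
    IsBoundedUnder (· ≤ ·) atTop (fun k => (1 / (n k : ℝ)) *
      (((Finset.range (n k)).filter fun j : ℕ => x j ≠ y j).card : ℝ)) :=
  isBoundedUnder_of ⟨1, fun k => (average_card_mem_Icc (n k) x y).2⟩

theorem dbarAlong_nonneg (n : ℕ → ℕ) (x y : FullShift) : 0 ≤ dbarAlong n x y :=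
  le_limsup_of_frequently_le (Frequently.of_forall fun k => (average_card_mem_Icc (n k) x y).1)
    (isBoundedUnder_average n x y)

theorem dbarAlong_le_of_tendsto {n : ℕ → ℕ} {x y : FullShift} {u : ℕ → ℝ} {a : ℝ}
    (hu : Tendsto u atTop (𝓝 a))
    (h : ∀ k, (1 / (n k : ℝ)) *
      (((Finset.range (n k)).filter fun j : ℕ => x j ≠ y j).card : ℝ) ≤ u k) :
    dbarAlong n x y ≤ a := by
  rw [← hu.limsup_eq]
  exact limsup_le_limsup (Eventually.of_forall h)
    (isBoundedUnder_of ⟨0, fun k => (average_card_mem_Icc (n k) x y).1⟩).isCoboundedUnder_le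
    hu.isBoundedUnder_le

theorem exists_isDavenportErdosSeq {B : Set ℕ} (hB : 0 ∉ B) : ∃ n, IsDavenportErdosSeq B n := by
  have h0 : ∀ m, 0 ∉ initialPart B m := fun m h => hB (initialPart_subset B m h)
  choose a ha using fun m => exists_tendsto_countIn_multiples (finite_initialPart B m) (h0 m)
  have hmono : Monotone a := fun m m' h => le_of_tendsto_of_tendsto' (ha m) (ha m') fun x =>
    div_le_div_of_nonneg_right
      (by exact_mod_cast countIn_mono (multiples_mono (initialPart_mono B h)) x) (by positivity)
  have hle : ∀ m, a m ≤ 1 := fun m => le_of_tendsto' (ha m) fun x =>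
    div_le_one_of_le₀ (by exact_mod_cast countIn_le _ x) (by positivity)
  have hbdd : BddAbove (Set.range a) := ⟨1, by rintro _ ⟨m, rfl⟩; exact hle m⟩
  set A := ⨆ m, a m with hA
  have hlim : Tendsto a atTop (𝓝 A) := tendsto_atTop_ciSup hmono hbdd
  have hA0 : 0 ≤ A := (ge_of_tendsto' (ha 0) fun x => by positivity).trans (le_ciSup hbdd 0)
  have hD : ∀ ε : ℝ, 0 < ε → ∀ D, ∑ n ∈ Finset.Ioc 0 D,
      (multiples B).indicator (fun n : ℕ => (n : ℝ) ^ (-(1 + ε))) n ≤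
        A * ∑' n : ℕ, (n : ℝ) ^ (-(1 + ε)) := by
    intro ε hε D
    -- A divisor b ∈ B of some positive n ≤ D satisfies b < D + 1, so up to D the multiples of B are
    -- those of B(D + 1), whose density is at most A.
    refine le_trans (le_of_eq ?_) ((sum_rpow_le_of_tendsto_countIn mul_mem_multiples
      (ha (D + 1)) hε D).trans (mul_le_mul_of_nonneg_right (le_ciSup hbdd (D + 1))
        (tsum_nonneg fun n => rpow_neg_one_add n)))
    refine Finset.sum_congr rfl fun n hn => ?_
    obtain ⟨hn0, hnD⟩ := Finset.mem_Ioc.1 hn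
    have : n ∈ multiples B ↔ n ∈ multiples (initialPart B (D + 1)) := by
      refine ⟨fun ⟨b, hb, hbn⟩ => ⟨b, mem_initialPart hb ?_, hbn⟩,
        fun h => multiples_mono (initialPart_subset B _) h⟩
      exact Nat.lt_succ_of_le ((Nat.le_of_dvd hn0 hbn).trans hnD)
    classical
    simp only [Set.indicator_apply, this]
  have hfreq : ∀ k : ℕ, ∃ᶠ x : ℕ in atTop,
      (countIn (multiples B) x : ℝ) < (A + 1 / ((k : ℝ) + 1)) * x ∧ 0 < x := fun k =>
    (frequently_countIn_lt hA0 (lt_add_of_pos_right A Nat.one_div_pos_of_nat) hD).and_eventually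
      (eventually_gt_atTop 0)
  -- The k-th term is chosen with slack 1/(k+1) over A. Subtracting the density of the multiples of
  -- B(m) leaves an upper density of disagreements of at most A - a m.
  obtain ⟨n, hn, hn'⟩ := extraction_forall_of_frequently hfreq
  refine ⟨n, hn, fun k => (hn' k).2, ?_⟩
  have hle : ∀ m, dbarAlong n (eta (initialPart B m)) (eta B) ≤ A - a m := by
    intro m
    have hu : Tendsto (fun k => 1 / (n k : ℝ) + (A + 1 / ((k : ℝ) + 1) -
        (countIn (multiples (initialPart B m)) (n k) : ℝ) / n k)) atTop
        (𝓝 (0 + (A + 0 - a m))) :=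
      (tendsto_one_div_atTop_nhds_zero_nat.comp hn.tendsto_atTop).add
        ((tendsto_const_nhds.add tendsto_one_div_add_atTop_nhds_zero_nat).sub
          ((ha m).comp hn.tendsto_atTop))
    rw [zero_add, add_zero] at hu
    refine dbarAlong_le_of_tendsto hu fun k => ?_
    have hpos : (0 : ℝ) < n k := by exact_mod_cast (hn' k).2
    have h1 := card_filter_eta_ne_le (initialPart_subset B m) (n k)
    have h2 := (hn' k).1
    rw [one_div_mul_eq_div, div_le_iff₀ hpos]
    refine h1.trans ?_
    have h3 : (1 / (n k : ℝ) + (A + 1 / ((k : ℝ) + 1) -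
        (countIn (multiples (initialPart B m)) (n k) : ℝ) / n k)) * n k =
        1 + ((A + 1 / ((k : ℝ) + 1)) * n k - countIn (multiples (initialPart B m)) (n k)) := by
      field_simp
    rw [h3]
    linarith
  refine squeeze_zero (fun m => dbarAlong_nonneg _ _ _) hle ?_
  simpa using (tendsto_const_nhds (x := A)).sub hlim

/-! ### Quasi-genericity -/

/-- Compactness: counterexamples for all windows would accumulate at a pair of equal points on which
f still differs by ε. -/
theorem exists_window_norm_sub_lt (f : C(FullShift, ℂ)) {ε : ℝ} (hε : 0 < ε) :
    ∃ K : ℕ, ∀ x y : FullShift, (∀ i ∈ Finset.Icc (-(K : ℤ)) K, x i = y i) →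
      ‖f x - f y‖ < ε := by
  by_contra! hcon
  let A : ℕ → Set (FullShift × FullShift) := fun K =>
    {p | (∀ i ∈ Finset.Icc (-(K : ℤ)) K, p.1 i = p.2 i) ∧ ε ≤ ‖f p.1 - f p.2‖}
  have hA : ∀ K, IsClosed (A K) := by
    intro K
    refine IsClosed.and ?_ (isClosed_le continuous_const (by fun_prop))
    simp only [Set.ofPred_forall]
    exact isClosed_biInter fun i _ => isClosed_eq (by fun_prop) (by fun_prop)
  obtain ⟨p, hp⟩ := IsCompact.nonempty_iInter_of_sequence_nonempty_isCompact_isClosed A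
    (fun K p hp => ⟨fun i hi => hp.1 i (by simp only [Finset.mem_Icc] at hi ⊢; push_cast; omega),
      hp.2⟩)
    (fun K => by obtain ⟨x, y, h, h'⟩ := hcon K; exact ⟨(x, y), h, h'⟩)
    (hA 0).isCompact hA
  rw [Set.mem_iInter] at hp
  have : p.1 = p.2 := funext fun i => (hp i.natAbs).1 i (by rw [Finset.mem_Icc]; omega)
  have h := (hp 0).2
  rw [this, sub_self, norm_zero] at h
  linarith

/-- Translating by i moves at most |i| positions out of [0, n). -/
theorem card_filter_add_ne_le (x y : FullShift) (n : ℕ) (i : ℤ) :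
    ((Finset.range n).filter fun j : ℕ => x (i + j) ≠ y (i + j)).card ≤
      ((Finset.range n).filter fun j : ℕ => x j ≠ y j).card + i.natAbs := by
  classical
  have h1 : ((Finset.range n).filter fun j : ℕ => x (i + j) ≠ y (i + j)).image
      (fun j : ℕ => i + (j : ℤ)) ⊆
      ((Finset.range n).filter fun j : ℕ => x j ≠ y j).image (fun j : ℕ => (j : ℤ)) ∪
        if 0 ≤ i then Finset.Ico (n : ℤ) (n + i) else Finset.Ico i 0 := by
    intro k hk
    obtain ⟨j, hj, rfl⟩ := Finset.mem_image.1 hk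
    rw [Finset.mem_filter, Finset.mem_range] at hj
    rw [Finset.mem_union]
    by_cases h : 0 ≤ i + (j : ℤ) ∧ i + (j : ℤ) < n
    · left
      refine Finset.mem_image.2 ⟨(i + (j : ℤ)).toNat, ?_, Int.toNat_of_nonneg h.1⟩
      rw [Finset.mem_filter, Finset.mem_range, Int.toNat_of_nonneg h.1]
      exact ⟨by omega, hj.2⟩
    · right
      split_ifs <;> rw [Finset.mem_Ico] <;> omega
  have h2 := (Finset.card_le_card h1).trans (Finset.card_union_le _ _)
  rw [Finset.card_image_of_injective _ (fun a b h => by simpa using h),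
    Finset.card_image_of_injective _ Nat.cast_injective] at h2
  refine h2.trans (Nat.add_le_add_left ?_ _)
  split_ifs <;> rw [Int.card_Ico] <;> omega

/-- A time j is bad if the window of radius K around j sees a disagreement. Each of the 2K + 1
offsets yields at most d + K bad times, K being the boundary loss; a bad time costs at most 2‖f‖ and
any other less than ε. -/
theorem norm_average_sub_average_le (f : C(FullShift, ℂ)) {ε : ℝ} (hε : 0 ≤ ε) {K : ℕ}
    (hK : ∀ x y : FullShift, (∀ i ∈ Finset.Icc (-(K : ℤ)) K, x i = y i) → ‖f x - f y‖ < ε)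
    (x y : FullShift) {n : ℕ} (hn : 0 < n) :
    ‖(1 / (n : ℂ)) * ∑ j ∈ Finset.range n, f (shift^[j] x) -
        (1 / (n : ℂ)) * ∑ j ∈ Finset.range n, f (shift^[j] y)‖ ≤
      ε + 2 * ‖f‖ * ((2 * K + 1) * ((1 / (n : ℝ)) *
        (((Finset.range n).filter fun j : ℕ => x j ≠ y j).card : ℝ) + K * (1 / (n : ℝ)))) := by
  classical
  set d := ((Finset.range n).filter fun j : ℕ => x j ≠ y j).card with hd
  set S := (Finset.range n).filter
    fun j : ℕ => ∃ i ∈ Finset.Icc (-(K : ℤ)) K, x (i + j) ≠ y (i + j) with hS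
  have hScard : S.card ≤ (2 * K + 1) * (d + K) := by
    have h1 : S ⊆ (Finset.Icc (-(K : ℤ)) K).biUnion fun i =>
        (Finset.range n).filter fun j : ℕ => x (i + j) ≠ y (i + j) := by
      intro j hj
      obtain ⟨hj, i, hi, h⟩ := Finset.mem_filter.1 hj
      exact Finset.mem_biUnion.2 ⟨i, hi, Finset.mem_filter.2 ⟨hj, h⟩⟩
    refine (Finset.card_le_card h1).trans (Finset.card_biUnion_le.trans ?_)
    refine (Finset.sum_le_card_nsmul _ _ (d + K) fun i hi => ?_).trans_eq ?_
    · refine (card_filter_add_ne_le x y n i).trans (Nat.add_le_add_left ?_ _)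
      rw [Finset.mem_Icc] at hi
      omega
    · rw [Int.card_Icc, smul_eq_mul]
      congr 1
      omega
  have hterm : ∀ j ∈ Finset.range n, ‖f (shift^[j] x) - f (shift^[j] y)‖ ≤
      ε + if j ∈ S then 2 * ‖f‖ else 0 := by
    intro j hj
    split_ifs with h
    · have h1 := norm_sub_le (f (shift^[j] x)) (f (shift^[j] y))
      have h2 := f.norm_coe_le_norm (shift^[j] x)
      have h3 := f.norm_coe_le_norm (shift^[j] y)
      linarith
    · rw [add_zero]
      refine (hK _ _ fun i hi => ?_).le
      rw [shift_iterate_apply, shift_iterate_apply]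
      by_contra hne
      exact h (Finset.mem_filter.2 ⟨hj, i, hi, hne⟩)
  have hn' : (0 : ℝ) < n := by exact_mod_cast hn
  rw [← mul_sub, ← Finset.sum_sub_distrib, norm_mul, norm_div, norm_one, Complex.norm_natCast]
  have hsum : ‖∑ j ∈ Finset.range n, (f (shift^[j] x) - f (shift^[j] y))‖ ≤
      n * ε + 2 * ‖f‖ * S.card := by
    refine (norm_sum_le _ _).trans ((Finset.sum_le_sum hterm).trans_eq ?_)
    rw [Finset.sum_add_distrib, Finset.sum_const, Finset.card_range, nsmul_eq_mul,
      Finset.sum_ite_mem, Finset.sum_const, Finset.inter_eq_right.2 (Finset.filter_subset _ _),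
      nsmul_eq_mul]
    ring
  have hScard' : (S.card : ℝ) ≤ (2 * K + 1) * (d + K) := by exact_mod_cast hScard
  calc 1 / (n : ℝ) * ‖∑ j ∈ Finset.range n, (f (shift^[j] x) - f (shift^[j] y))‖
      ≤ 1 / (n : ℝ) * (n * ε + 2 * ‖f‖ * ((2 * K + 1) * (d + K))) := by
        refine mul_le_mul_of_nonneg_left (hsum.trans ?_) (by positivity)
        gcongr
    _ = _ := by field_simp

theorem tendsto_average_of_mem_periodicPts {x : FullShift} (hx : x ∈ Function.periodicPts shift)
    (f : C(FullShift, ℂ)) :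
    Tendsto (fun n : ℕ => (1 / (n : ℂ)) * ∑ j ∈ Finset.range n, f (shift^[j] x)) atTop
      (𝓝 (∫ y, f y ∂periodicMeasure x)) := by
  rw [integral_periodicMeasure]
  refine tendsto_average_of_periodic (Function.minimalPeriod_pos_of_mem_periodicPts hx) fun j => ?_
  rw [Function.iterate_add_minimalPeriod_eq]

theorem isQuasiGeneric_mirsky {B : Set ℕ} (hB : 0 ∉ B) {n : ℕ → ℕ}
    (hn : IsDavenportErdosSeq B n) : IsQuasiGeneric shift (mirsky B) n (eta B) := by
  obtain ⟨hmono, hpos, hd⟩ := hn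
  have h0 : ∀ m, 0 ∉ initialPart B m := fun m h => hB (initialPart_subset B m h)
  intro f
  refine Metric.tendsto_nhds.2 fun r hr => ?_
  obtain ⟨K, hK⟩ := exists_window_norm_sub_lt f (ε := r / 4) (by linarith)
  set c : ℝ := 2 * ‖f‖ * (2 * K + 1) with hc
  have hc0 : 0 ≤ c := by positivity
  -- The error r is split into four quarters: window, disagreements, periodic average, and
  -- convergence of integrals. The c + 1 avoids dividing by zero when f = 0.
  set s : ℝ := r / (16 * (c + 1)) with hs
  have hs0 : 0 < s := by positivity
  have hcs : c * (s + s) ≤ r / 4 := by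
    have : (c + 1) * s = r / 16 := by rw [hs]; field_simp
    nlinarith
  obtain ⟨m, hm1, hm2⟩ := ((hd.eventually_lt_const hs0).and
    ((Metric.tendsto_nhds.1 (tendsto_integral_mirsky B f)) (r / 4) (by linarith))).exists
  rw [mirsky_eq_periodicMeasure (finite_initialPart B m) (h0 m)] at hm2
  have h1 := eventually_lt_of_limsup_lt hm1 (isBoundedUnder_average n _ _)
  have h2 : ∀ᶠ k in atTop, (K : ℝ) * (1 / (n k : ℝ)) < s := by
    have := (tendsto_one_div_atTop_nhds_zero_nat (𝕜 := ℝ)).comp hmono.tendsto_atTop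
    have := this.const_mul (K : ℝ)
    rw [mul_zero] at this
    exact this.eventually_lt_const hs0
  have h3 := (Metric.tendsto_nhds.1 ((tendsto_average_of_mem_periodicPts
    (eta_mem_periodicPts (finite_initialPart B m) (h0 m)) f).comp hmono.tendsto_atTop))
    (r / 4) (by linarith)
  filter_upwards [h1, h2, h3] with k hk1 hk2 hk3
  have h4 := norm_average_sub_average_le f (by linarith) hK (eta (initialPart B m)) (eta B) (hpos k)
  rw [← mul_assoc, ← hc, ← dist_eq_norm, dist_comm] at h4
  have h5 := mul_le_mul_of_nonneg_left (add_lt_add hk1 hk2).le hc0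
  have h6 := dist_triangle4 ((1 / (n k : ℂ)) * ∑ j ∈ Finset.range (n k), f (shift^[j] (eta B)))
    ((1 / (n k : ℂ)) * ∑ j ∈ Finset.range (n k), f (shift^[j] (eta (initialPart B m))))
    (∫ y, f y ∂periodicMeasure (eta (initialPart B m))) (∫ y, f y ∂mirsky B)
  have h7 : dist ((1 / (n k : ℂ)) * ∑ j ∈ Finset.range (n k),
    f (shift^[j] (eta (initialPart B m)))) (∫ y, f y ∂periodicMeasure (eta (initialPart B m))) <
      r / 4 := hk3
  linarith

/-- A clopen set missing the subshift is never visited by the orbit of `eta B`, so quasi-genericity,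
applied to its continuous indicator, gives it measure 0. Such sets cover the complement. -/
theorem isErgodicMeasureOn_mirsky {B : Set ℕ} (hB : 0 ∉ B) :
    IsErgodicMeasureOn (freeShift B) (mirsky B) := by
  refine ⟨inferInstance, ergodic_mirsky B, ?_⟩
  have hclosed : IsClosed (freeShift B) := isClosed_closure
  refine (prob_compl_eq_zero_iff hclosed.measurableSet).1 ?_
  refine measure_null_of_locally_null _ fun x hx => ?_
  obtain ⟨V, hV, hxV, hVsub⟩ := compact_exists_isClopen_in_isOpen hclosed.isOpen_compl hx
  refine ⟨V, mem_nhdsWithin_of_mem_nhds (hV.isOpen.mem_nhds hxV), ?_⟩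
  let f : C(FullShift, ℂ) := ⟨V.indicator 1, hV.continuous_indicator continuous_const⟩
  obtain ⟨n, hn⟩ := exists_isDavenportErdosSeq hB
  have h := isQuasiGeneric_mirsky hB hn f
  have hzero : ∀ j, f (shift^[j] (eta B)) = 0 := fun j =>
    Set.indicator_of_notMem (fun hj => hVsub hj
      (subset_closure ⟨j, by funext i; rw [shift_iterate_apply]⟩)) _
  simp only [hzero, Finset.sum_const_zero, mul_zero] at h
  have h2 := tendsto_nhds_unique tendsto_const_nhds h
  change 0 = ∫ y, V.indicator (fun _ => (1 : ℂ)) y ∂mirsky B at h2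
  rw [integral_indicator_const _ hV.isOpen.measurableSet, Complex.real_smul, mul_one] at h2
  rw [← measureReal_eq_zero_iff]
  exact_mod_cast h2.symm

/-! ### Rational discrete spectrum -/

/-! ### Isometries with a dense set of periodic vectors -/

section Isometry

variable {E : Type*} [NormedAddCommGroup E] [InnerProductSpace ℂ E]

/-- Averages of the orbit of x stay in the closed ball around x, and by the mean ergodic theorem
they converge to a fixed vector. -/
theorem exists_fixed_near_of_forall_iterate_near [CompleteSpace E] (V : E →ₗᵢ[ℂ] E) (x : E) {δ : ℝ}
    (h : ∀ k, ‖V^[k] x - x‖ ≤ δ) : ∃ y, V y = y ∧ ‖y - x‖ ≤ δ := by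
  have hlim := V.toContinuousLinearMap.tendsto_birkhoffAverage_orthogonalProjection
    V.norm_toContinuousLinearMap_le x
  refine ⟨_, (Subtype.property ((V.toContinuousLinearMap.eqLocus
    (1 : E →L[ℂ] E)).orthogonalProjectionOnto x) :), ?_⟩
  refine le_of_tendsto ((hlim.sub_const x).norm) ?_
  filter_upwards [eventually_gt_atTop 0] with N hN
  have hN' : (N : ℂ) ≠ 0 := by exact_mod_cast hN.ne'
  have h1 : birkhoffAverage ℂ V.toContinuousLinearMap _root_.id N x - x =
      (N : ℂ)⁻¹ • ∑ k ∈ Finset.range N, (V^[k] x - x) := by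
    rw [Finset.sum_sub_distrib, smul_sub, Finset.sum_const, Finset.card_range,
      ← Nat.cast_smul_eq_nsmul ℂ, smul_smul, inv_mul_cancel₀ hN', one_smul]
    rfl
  rw [h1, norm_smul, norm_inv, Complex.norm_natCast, inv_mul_le_iff₀ (by exact_mod_cast hN)]
  exact (norm_sum_le_of_le _ fun k _ => h k).trans_eq (by simp)

/-- The polynomial X^q - 1 is a product of distinct linear factors, so its kernel at U is the sum of
the eigenspaces for its roots. -/
theorem mem_span_eigenvectors_of_pow_eq {U : Module.End ℂ E} {q : ℕ} (hq : 0 < q) {f : E}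
    (hf : (U ^ q) f = f) : f ∈ Submodule.span ℂ {f : E | ∃ ξ : ℂ, U.HasEigenvector ξ f} := by
  open Polynomial in
  have key : ∀ s : Finset ℂ, LinearMap.ker (aeval U (∏ ξ ∈ s, (X - C ξ))) ≤
      Submodule.span ℂ {f : E | ∃ ξ : ℂ, U.HasEigenvector ξ f} := by
    classical
    intro s
    induction s using Finset.induction_on with
    | empty =>
      intro v hv
      have : v = 0 := by simpa using hv
      rw [this]; exact Submodule.zero_mem _
    | insert ξ s hξ ih =>
      have hcop : IsCoprime (X - C ξ) (∏ ξ ∈ s, (X - C ξ)) :=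
        IsCoprime.prod_right fun η hη =>
          Polynomial.isCoprime_X_sub_C_of_isUnit_sub
            (sub_ne_zero.2 fun h : ξ = η => hξ (h ▸ hη)).isUnit
      rw [Finset.prod_insert hξ, ← Polynomial.sup_ker_aeval_eq_ker_aeval_mul_of_coprime U hcop]
      refine sup_le (fun v hv => ?_) ih
      by_cases hv0 : v = 0
      · rw [hv0]; exact Submodule.zero_mem _
      · refine Submodule.subset_span ⟨ξ, Module.End.mem_eigenspace_iff.2 ?_, hv0⟩
        simpa [sub_eq_zero] using hv
  refine key (Polynomial.nthRootsFinset q 1) ?_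
  rw [← Polynomial.X_pow_sub_one_eq_prod hq (Complex.isPrimitiveRoot_exp q hq.ne')]
  simp [hf]

/-- A periodic h closer to f than ‖f‖ cannot be orthogonal to f, and ⟨h, f⟩ = ⟨U^q h, U^q f⟩ = ξ^q
⟨h, f⟩. -/
theorem pow_eq_one_of_dense_periodic {U : E →ₗᵢ[ℂ] E}
    (hU : Dense {f : E | ∃ q : ℕ, 0 < q ∧ U^[q] f = f}) {ξ : ℂ} {f : E} (hf0 : f ≠ 0)
    (hf : U f = ξ • f) : ∃ q : ℕ, 0 < q ∧ ξ ^ q = 1 := by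
  obtain ⟨h, hfh, q, hq, hh⟩ := Metric.dense_iff.1 hU f ‖f‖ (norm_pos_iff.2 hf0)
  rw [Metric.mem_ball, dist_eq_norm] at hfh
  have hne : inner ℂ h f ≠ 0 := by
    intro h0
    have := norm_sub_sq (𝕜 := ℂ) h f
    rw [h0] at this
    simp only [map_zero, mul_zero, sub_zero] at this
    nlinarith [norm_nonneg (h - f), norm_nonneg f, sq_nonneg ‖h‖]
  have hpow : ∀ k, U^[k] f = ξ ^ k • f := by
    intro k
    induction k with
    | zero => simp
    | succ k ih => rw [Function.iterate_succ_apply', ih, map_smul, hf, smul_smul, pow_succ]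
  refine ⟨q, hq, ?_⟩
  have h1 : inner ℂ ((U ^ q) h) ((U ^ q) f) = inner ℂ h f := (U ^ q).inner_map_map h f
  rw [LinearIsometry.coe_pow, hh, hpow, inner_smul_right] at h1
  exact mul_right_cancel₀ hne (h1.trans (one_mul _).symm)

end Isometry

/-! ### Almost periodic sets and the Koopman operator -/

section Koopman

variable {X : Type*} [MeasurableSpace X] {T : X → X} {μ : Measure X} [IsProbabilityMeasure μ]

theorem dense_periodic_of_almostPeriodic_sets (hT : MeasurePreserving T μ μ)
    (h : ∀ S, MeasurableSet S → ∀ ε : ℝ, 0 < ε → ∃ q : ℕ, 0 < q ∧ ∀ k : ℕ,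
      μ.real (symmDiff (T^[q * k] ⁻¹' S) S) ≤ ε) :
    Dense {f : Lp ℂ 2 μ | ∃ q : ℕ, 0 < q ∧
      (Lp.compMeasurePreservingₗᵢ (p := 2) ℂ T hT)^[q] f = f} := by
  set U := Lp.compMeasurePreservingₗᵢ (E := ℂ) (p := 2) ℂ T hT with hU
  have hiter : ∀ (q k : ℕ) (f : Lp ℂ 2 μ), U^[q] f = f → U^[q * k] f = f := by
    intro q k f hf
    rw [Function.iterate_mul]
    exact Function.iterate_fixed hf k
  have hadd : ∀ f g : Lp ℂ 2 μ, f ∈ closure {f : Lp ℂ 2 μ | ∃ q : ℕ, 0 < q ∧ U^[q] f = f} →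
      g ∈ closure {f : Lp ℂ 2 μ | ∃ q : ℕ, 0 < q ∧ U^[q] f = f} →
      f + g ∈ closure {f : Lp ℂ 2 μ | ∃ q : ℕ, 0 < q ∧ U^[q] f = f} := by
    intro f g hf hg
    refine map_mem_closure₂ continuous_add hf hg ?_
    rintro a ⟨q, hq, ha⟩ b ⟨r, hr, hb⟩
    refine ⟨q * r, Nat.mul_pos hq hr, ?_⟩
    rw [← LinearIsometry.coe_pow, map_add, LinearIsometry.coe_pow, hiter q r a ha, mul_comm q r,
      hiter r q b hb]
  intro f
  induction f using Lp.induction with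
  | hp_ne_top => simp
  | indicatorConst c hS hμS =>
    rename_i S
    rw [Lp.simpleFunc.coe_indicatorConst]
    refine Metric.mem_closure_iff.2 fun ε hε => ?_
    -- The square compensates the square root in the L² norm of an indicator; ‖c‖ + 1 covers c = 0.
    obtain ⟨q, hq, hqk⟩ := h S hS ((ε / (2 * (‖c‖ + 1))) ^ 2) (by positivity)
    have hnear : ∀ k, ‖(U ^ q)^[k] (indicatorConstLp 2 hS hμS.ne c) -
        indicatorConstLp 2 hS hμS.ne c‖ ≤ ε / 2 := by
      intro k
      rw [LinearIsometry.coe_pow, ← Function.iterate_mul]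
      have h1 : U^[q * k] (indicatorConstLp 2 hS hμS.ne c) = indicatorConstLp 2
          (hS.preimage (hT.iterate (q * k)).measurable) (by finiteness) c := by
        have := congrFun (Lp.compMeasurePreserving_iterate (E := ℂ) (p := 2) hT (q * k))
          (indicatorConstLp 2 hS hμS.ne c)
        rw [Lp.indicatorConstLp_compMeasurePreserving] at this
        exact this
      rw [h1, ← dist_eq_norm, dist_indicatorConstLp_eq_norm,
        norm_indicatorConstLp (by simp) (by simp)]
      have h2 : μ.real (symmDiff (T^[q * k] ⁻¹' S) S) ^ (1 / (2 : ℝ≥0∞).toReal) ≤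
          ε / (2 * (‖c‖ + 1)) := by
        rw [ENNReal.toReal_ofNat, ← Real.sqrt_eq_rpow]
        exact Real.sqrt_le_iff.2 ⟨by positivity, hqk k⟩
      refine (mul_le_mul_of_nonneg_left h2 (norm_nonneg c)).trans ?_
      rw [mul_div_assoc', div_le_div_iff₀ (by positivity) (by positivity)]
      nlinarith [norm_nonneg c]
    obtain ⟨y, hy, hyx⟩ := exists_fixed_near_of_forall_iterate_near (U ^ q) _ hnear
    refine ⟨y, ⟨q, hq, by rw [← LinearIsometry.coe_pow]; exact hy⟩, ?_⟩
    rw [dist_comm, dist_eq_norm]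
    linarith
  | add hf hg _ ihf ihg => exact hadd _ _ ihf ihg
  | isClosed => exact isClosed_closure

theorem hasRationalDiscreteSpectrum_of_almostPeriodic_sets (hT : MeasurePreserving T μ μ)
    (h : ∀ S, MeasurableSet S → ∀ ε : ℝ, 0 < ε → ∃ q : ℕ, 0 < q ∧ ∀ k : ℕ,
      μ.real (symmDiff (T^[q * k] ⁻¹' S) S) ≤ ε) :
    HasRationalDiscreteSpectrum T μ hT := by
  have hdense := dense_periodic_of_almostPeriodic_sets hT h
  refine ⟨hdense.mono ?_, fun ξ hξ => ?_⟩
  · rintro f ⟨q, hq, hf⟩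
    refine mem_span_eigenvectors_of_pow_eq hq ?_
    rw [Module.End.pow_apply]
    exact hf
  · obtain ⟨f, hf⟩ := hξ.exists_hasEigenvector
    exact pow_eq_one_of_dense_periodic hdense hf.2 hf.apply_eq_smul

end Koopman

open Odometer

theorem exists_periodic_approx {A : Set Odometer} (hA : MeasurableSet A) {ε : ℝ} (hε : 0 < ε) :
    ∃ S, MeasurableSet S ∧ (∃ q : ℕ, 0 < q ∧ ∀ g, rot^[q] g ∈ S ↔ g ∈ S) ∧
      haar.real (symmDiff A S) < ε := by
  obtain ⟨S, ⟨hS, hq⟩, h⟩ := measureDense_periodicSets.approx A hA (measure_ne_top _ _) ε hε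
  exact ⟨S, hS, hq, ENNReal.toReal_lt_of_lt_ofReal h⟩

/-- Almost periodicity of sets passes to factors by pulling them back. If A is ε/2-close to a
q-periodic set, every preimage under the qk-th power is ε/2-close to that same set, hence ε-close to
A. -/
theorem hasRationalDiscreteSpectrum_mirsky (B : Set ℕ) :
    HasRationalDiscreteSpectrum shift (mirsky B) (ergodic_mirsky B).toMeasurePreserving := by
  refine hasRationalDiscreteSpectrum_of_almostPeriodic_sets _ fun S hS ε hε => ?_
  set A := code B ⁻¹' S with hA
  have hAm : MeasurableSet A := measurable_code B hS
  obtain ⟨S', hS', ⟨q, hq, hper⟩, hlt⟩ := exists_periodic_approx hAm (half_pos hε)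
  refine ⟨q, hq, fun k => ?_⟩
  have hTk := ergodic_rot.toMeasurePreserving.iterate (q * k)
  have h1 : (mirsky B).real (symmDiff (shift^[q * k] ⁻¹' S) S) =
      haar.real (symmDiff (rot^[q * k] ⁻¹' A) A) := by
    rw [mirsky, map_measureReal_apply (measurable_code B)
      ((hS.preimage (measurable_shift.iterate _)).symmDiff hS), Set.preimage_symmDiff,
      ← Set.preimage_comp, ← Set.preimage_comp, ((semiconj_code B).iterate_right _).comp_eq]
  have h2 : rot^[q * k] ⁻¹' S' = S' := by
    ext g
    exact rot_iterate_mul_mem_iff hper k g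
  have h3 : haar.real (symmDiff (rot^[q * k] ⁻¹' A) S') = haar.real (symmDiff A S') := by
    conv_lhs => rw [← h2]
    rw [← Set.preimage_symmDiff]
    exact hTk.measureReal_preimage (hAm.symmDiff hS').nullMeasurableSet
  have h4 := measureReal_symmDiff_le (μ := haar) (s := rot^[q * k] ⁻¹' A) (t := S') A
  rw [h1]
  rw [h3, symmDiff_comm S' A] at h4
  linarith

/-! ### Zero entropy -/

/-- Gibbs' inequality. -/
theorem sum_negMulLog_le_of_sum_le_one {κ : Type*} [Fintype κ] {p w : κ → ℝ}
    (hp : ∀ c, 0 ≤ p c) (hp1 : ∑ c, p c = 1) (hw : ∀ c, 0 < w c) (hw1 : ∑ c, w c ≤ 1) :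
    ∑ c, Real.negMulLog (p c) ≤ ∑ c, p c * -Real.log (w c) := by
  have h : ∀ c, Real.negMulLog (p c) ≤ p c * -Real.log (w c) + (w c - p c) := by
    intro c
    rcases (hp c).eq_or_lt with h0 | h0
    · rw [← h0]; simp [(hw c).le]
    · have h1 := Real.log_le_sub_one_of_pos (div_pos (hw c) h0)
      rw [Real.log_div (hw c).ne' h0.ne'] at h1
      have h2 := mul_le_mul_of_nonneg_left h1 h0.le
      have h3 : p c * (w c / p c - 1) = w c - p c := by field_simp
      rw [Real.negMulLog]
      linarith
  have := Finset.sum_le_sum fun c (_ : c ∈ Finset.univ) => h c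
  rw [Finset.sum_add_distrib, Finset.sum_sub_distrib, hp1] at this
  linarith

/-- The transition probabilities of a symmetric noisy channel. -/
noncomputable def channel {r : ℕ} (θ : ℝ) (a b : Fin r) : ℝ := if a = b then 1 - θ else θ / r

/-! ### Coding by a noisy periodic word -/

section Channel

variable {r : ℕ} {θ : ℝ}

theorem channel_pos (h0 : 0 < θ) (h1 : θ < 1) (a b : Fin r) : 0 < channel θ a b := by
  have hr : (0 : ℝ) < r := by exact_mod_cast a.pos
  unfold channel
  split_ifs
  · linarith
  · positivity

theorem sum_channel_le_one (h0 : 0 < θ) (b : Fin r) : ∑ a, channel θ a b ≤ 1 := by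
  have hr : (0 : ℝ) < r := by exact_mod_cast b.pos
  have h : ∀ a, channel θ a b ≤ (if a = b then 1 - θ else 0) + θ / r := by
    intro a
    unfold channel
    split_ifs
    · have : 0 ≤ θ / r := by positivity
      linarith
    · linarith
  refine (Finset.sum_le_sum fun a _ => h a).trans ?_
  rw [Finset.sum_add_distrib, Finset.sum_ite_eq', if_pos (Finset.mem_univ b), Finset.sum_const,
    Finset.card_univ, Fintype.card_fin, nsmul_eq_mul, mul_div_cancel₀ _ hr.ne']
  linarith

theorem neg_log_channel_le (h0 : 0 < θ) (h1 : θ < 1) (a b : Fin r) :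
    -Real.log (channel θ a b) ≤ -Real.log (1 - θ) + if a ≠ b then Real.log (r / θ) else 0 := by
  have hr : (0 : ℝ) < r := by exact_mod_cast a.pos
  unfold channel
  by_cases h : a = b
  · simp [h]
  · rw [if_neg h, if_pos h, ← inv_div, Real.log_inv]
    have := Real.log_nonpos (by linarith : 0 ≤ 1 - θ) (by linarith)
    linarith

/-- The law of the output of the channel when the input is the `q`-periodic continuation of a
uniformly distributed word of length `q`. -/
noncomputable def channelLaw (θ : ℝ) {q : ℕ} (hq : 0 < q) {N : ℕ} (c : Fin N → Fin r) : ℝ :=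
  ((r : ℝ) ^ q)⁻¹ * ∑ u : Fin q → Fin r, ∏ j : Fin N, channel θ (c j) (u ⟨j % q, Nat.mod_lt _ hq⟩)

variable {q : ℕ} (hq : 0 < q) {N : ℕ}

theorem le_channelLaw (h0 : 0 < θ) (h1 : θ < 1) (c : Fin N → Fin r) (u : Fin q → Fin r) :
    ((r : ℝ) ^ q)⁻¹ * ∏ j : Fin N, channel θ (c j) (u ⟨j % q, Nat.mod_lt _ hq⟩) ≤
      channelLaw θ hq c := by
  refine mul_le_mul_of_nonneg_left ?_ (by positivity)
  exact Finset.single_le_sum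
    (f := fun u : Fin q → Fin r => ∏ j : Fin N, channel θ (c j) (u ⟨j % q, Nat.mod_lt _ hq⟩))
    (fun u _ => Finset.prod_nonneg fun j _ => (channel_pos h0 h1 _ _).le) (Finset.mem_univ u)

theorem channelLaw_pos (hr : 0 < r) (h0 : 0 < θ) (h1 : θ < 1) (c : Fin N → Fin r) :
    0 < channelLaw θ hq c :=
  (mul_pos (by positivity) (Finset.prod_pos fun j _ => channel_pos h0 h1 _ _)).trans_le
    (le_channelLaw hq h0 h1 c fun _ => ⟨0, hr⟩)

theorem sum_channelLaw_le_one (hr : 0 < r) (h0 : 0 < θ) (h1 : θ < 1) :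
    ∑ c : Fin N → Fin r, channelLaw θ hq c ≤ 1 := by
  unfold channelLaw
  rw [← Finset.mul_sum, Finset.sum_comm]
  have h : ∀ u : Fin q → Fin r, ∑ c : Fin N → Fin r,
      ∏ j : Fin N, channel θ (c j) (u ⟨j % q, Nat.mod_lt _ hq⟩) ≤ 1 := by
    intro u
    have := Finset.prod_univ_sum (fun _ : Fin N => (Finset.univ : Finset (Fin r)))
      (fun (j : Fin N) a => channel θ a (u ⟨j % q, Nat.mod_lt _ hq⟩))
    rw [Fintype.piFinset_univ] at this
    rw [← this]
    exact Finset.prod_le_one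
      (fun j _ => Finset.sum_nonneg fun a _ => (channel_pos h0 h1 _ _).le)
      fun j _ => sum_channel_le_one h0 _
  have hr' : (0 : ℝ) < r := by exact_mod_cast hr
  refine (mul_le_mul_of_nonneg_left (Finset.sum_le_sum fun u _ => h u) (by positivity)).trans ?_
  simp [hr'.ne']

/-- Keeping only the input word u in the mixture costs q log r, the logarithm of the number of
words; each letter then costs -log(1 - θ), plus log(r/θ) where it disagrees. -/
theorem neg_log_channelLaw_le (hr : 0 < r) (h0 : 0 < θ) (h1 : θ < 1) (c : Fin N → Fin r)
    (u : Fin q → Fin r) :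
    -Real.log (channelLaw θ hq c) ≤ q * Real.log r + ∑ j : Fin N, (-Real.log (1 - θ) +
      if c j ≠ u ⟨j % q, Nat.mod_lt _ hq⟩ then Real.log (r / θ) else 0) := by
  have hr' : (0 : ℝ) < r := by exact_mod_cast hr
  have hprod : 0 < ∏ j : Fin N, channel θ (c j) (u ⟨j % q, Nat.mod_lt _ hq⟩) :=
    Finset.prod_pos fun j _ => channel_pos h0 h1 _ _
  have h := Real.log_le_log (mul_pos (by positivity) hprod) (le_channelLaw hq h0 h1 c u)
  rw [Real.log_mul (by positivity) hprod.ne', Real.log_inv, Real.log_pow,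
    Real.log_prod fun j _ => (channel_pos h0 h1 _ _).ne'] at h
  have h2 := Finset.sum_le_sum fun (j : Fin N) (_ : j ∈ Finset.univ) =>
    neg_log_channel_le h0 h1 (c j) (u ⟨j % q, Nat.mod_lt _ hq⟩)
  rw [Finset.sum_neg_distrib] at h2
  linarith

end Channel

section Entropy

variable {X : Type*} [MeasurableSpace X] {T : X → X} {μ : Measure X} [IsProbabilityMeasure μ]
  {r : ℕ} {P Q : X → Fin r}

/-- Gibbs' inequality bounds the entropy by the mean code length under `channelLaw`, for which being
a subprobability suffices. Each of the N times has disagreement probability μ(P ≠ Q) by invariance.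
-/
theorem partitionEntropy_le_of_periodic (hT : MeasurePreserving T μ μ) (hP : Measurable P)
    (hQ : Measurable Q) {q : ℕ} (hq : 0 < q) (hper : ∀ x, Q (T^[q] x) = Q x) {θ : ℝ} (h0 : 0 < θ)
    (h1 : θ < 1) (N : ℕ) :
    partitionEntropy μ (fun x => fun j : Fin N => P (T^[j] x)) ≤
      q * Real.log r + N * (-Real.log (1 - θ) + μ.real {x | P x ≠ Q x} * Real.log (r / θ)) := by
  obtain ⟨x₀⟩ := nonempty_of_isProbabilityMeasure μ
  have hr : 0 < r := (P x₀).pos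
  set name : X → Fin N → Fin r := fun x => fun j : Fin N => P (T^[j] x) with hname
  have hmeas : Measurable name :=
    measurable_pi_lambda _ fun j => hP.comp (hT.measurable.iterate _)
  have hmod : ∀ x j, Q (T^[j] x) = Q (T^[j % q] x) := by
    intro x j
    have h : ∀ k y, Q (T^[q * k] y) = Q y := by
      intro k
      induction k with
      | zero => simp
      | succ k ih =>
        intro y
        rw [Nat.mul_succ, add_comm, Function.iterate_add_apply, hper, ih]
    conv_lhs => rw [← Nat.div_add_mod j q, Function.iterate_add_apply, h]
  have : IsProbabilityMeasure (μ.map name) := Measure.isProbabilityMeasure_map hmeas.aemeasurable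
  have hp : ∀ c, μ.real (name ⁻¹' {c}) = (μ.map name).real {c} := fun c =>
    (map_measureReal_apply hmeas (MeasurableSet.singleton c)).symm
  have hsum1 : ∑ c, μ.real (name ⁻¹' {c}) = 1 := by
    simp only [hp]
    rw [sum_measureReal_singleton, Finset.coe_univ, probReal_univ]
  refine (sum_negMulLog_le_of_sum_le_one (fun c => measureReal_nonneg) hsum1
    (channelLaw_pos hq hr h0 h1) (sum_channelLaw_le_one hq hr h0 h1)).trans ?_
  have hint : ∑ c, μ.real (name ⁻¹' {c}) * -Real.log (channelLaw θ hq c) =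
      ∫ x, -Real.log (channelLaw θ hq (name x)) ∂μ := by
    rw [← integral_map (f := fun c => -Real.log (channelLaw θ hq c)) hmeas.aemeasurable
      (measurable_of_finite _).aestronglyMeasurable, integral_fintype (Integrable.of_finite)]
    simp only [hp, smul_eq_mul]
  set D : Set X := {x | P x ≠ Q x} with hD
  have hDm : MeasurableSet D := (measurableSet_eq_fun hP hQ).compl
  have hbound : ∀ x, -Real.log (channelLaw θ hq (name x)) ≤ q * Real.log r +
      ∑ j : Fin N, (-Real.log (1 - θ) + (T^[j] ⁻¹' D).indicator (fun _ => Real.log (r / θ)) x) := by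
    intro x
    -- The input word depends on x: it is the first period of the Q-name of x.
    refine (neg_log_channelLaw_le hq hr h0 h1 (name x) fun i => Q (T^[i] x)).trans_eq ?_
    congr 1
    refine Finset.sum_congr rfl fun j _ => ?_
    congr 1
    simp only [hname, ← hmod]
    classical
    rw [Set.indicator_apply]
    exact if_congr Iff.rfl rfl rfl
  have hi1 : ∀ j : Fin N, Integrable
      (fun x => -Real.log (1 - θ) + (T^[j] ⁻¹' D).indicator (fun _ => Real.log (r / θ)) x) μ :=
    fun j => (integrable_const _).add
      ((integrable_const _).indicator (hDm.preimage (hT.measurable.iterate _)))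
  rw [hint]
  refine (integral_mono ?_ ((integrable_const _).add (integrable_finsetSum _ fun j _ => hi1 j))
    hbound).trans_eq ?_
  · exact (Integrable.of_finite (μ := μ.map name)
      (f := fun c => -Real.log (channelLaw θ hq c))).comp_measurable hmeas
  · rw [integral_add' (integrable_const _) (integrable_finsetSum _ fun j _ => hi1 j),
      integral_const, probReal_univ, one_smul, integral_finsetSum _ fun j _ => hi1 j]
    congr 1
    have : ∀ j : Fin N, ∫ x, (-Real.log (1 - θ) +
        (T^[j] ⁻¹' D).indicator (fun _ => Real.log (r / θ)) x) ∂μ =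
        -Real.log (1 - θ) + μ.real D * Real.log (r / θ) := by
      intro j
      have hDj : MeasurableSet (T^[j] ⁻¹' D) := hDm.preimage (hT.measurable.iterate _)
      rw [integral_add (integrable_const _) ((integrable_const _).indicator hDj), integral_const,
        probReal_univ, one_smul, integral_indicator_const _ hDj, smul_eq_mul,
        (hT.iterate j).measureReal_preimage hDm.nullMeasurableSet]
    rw [Finset.sum_congr rfl fun j _ => this j, Finset.sum_const, Finset.card_univ,
      Fintype.card_fin, nsmul_eq_mul]

theorem entropyOfPartition_eq_zero_of_periodic_approx (hT : MeasurePreserving T μ μ)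
    (hP : Measurable P) (h : ∀ δ : ℝ, 0 < δ → ∃ Q : X → Fin r, Measurable Q ∧
      (∃ q : ℕ, 0 < q ∧ ∀ x, Q (T^[q] x) = Q x) ∧ μ.real {x | P x ≠ Q x} ≤ δ) :
    entropyOfPartition T μ P = 0 := by
  refine le_antisymm (ENNReal.le_of_forall_pos_le_add fun ε hε _ => ?_) zero_le
  rw [zero_add]
  have hε' : (0 : ℝ) < ε := hε
  obtain ⟨x₀⟩ := nonempty_of_isProbabilityMeasure μ
  have hr : (1 : ℝ) ≤ r := by exact_mod_cast (P x₀).pos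
  -- The noise θ is fixed first, spending half of ε; the accuracy of Q is then chosen so that the
  -- corrections cost at most the other half.
  obtain ⟨θ, h0, h1, hθ⟩ : ∃ θ : ℝ, 0 < θ ∧ θ < 1 ∧ -Real.log (1 - θ) = ε / 2 := by
    refine ⟨1 - Real.exp (-(ε / 2)), ?_, ?_, ?_⟩
    · have : Real.exp (-(ε / 2)) < 1 := by
        simpa using Real.exp_lt_exp.2 (by linarith : -((ε : ℝ) / 2) < 0)
      linarith
    · have := Real.exp_pos (-((ε : ℝ) / 2))
      linarith
    · rw [sub_sub_cancel, Real.log_exp, neg_neg]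
  have hlog : 0 < Real.log (r / θ) := Real.log_pos (by rw [lt_div_iff₀ h0]; linarith)
  obtain ⟨Q, hQ, ⟨q, hq, hper⟩, hδ⟩ := h (ε / 2 / Real.log (r / θ)) (by positivity)
  have hδ' : μ.real {x | P x ≠ Q x} * Real.log (r / θ) ≤ ε / 2 := (le_div_iff₀ hlog).1 hδ
  have hle : ∀ᶠ N : ℕ in atTop, ENNReal.ofReal
      (partitionEntropy μ (fun x => fun j : Fin N => P (T^[j] x)) / N) ≤
        ENNReal.ofReal (q * Real.log r * (1 / (N : ℝ)) + ε) := by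
    filter_upwards [eventually_gt_atTop 0] with N hN
    have hN' : (0 : ℝ) < N := by exact_mod_cast hN
    refine ENNReal.ofReal_le_ofReal ?_
    rw [div_le_iff₀ hN']
    refine (partitionEntropy_le_of_periodic hT hP hQ hq hper h0 h1 N).trans ?_
    have h2 : (q * Real.log r * (1 / (N : ℝ)) + ε) * N = q * Real.log r + N * ε := by field_simp
    rw [h2, hθ]
    have := mul_le_mul_of_nonneg_left hδ' hN'.le
    linarith
  have hlim : Tendsto (fun N : ℕ => ENNReal.ofReal (q * Real.log r * (1 / (N : ℝ)) + ε)) atTop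
      (𝓝 (ENNReal.ofReal (q * Real.log r * 0 + ε))) :=
    ENNReal.tendsto_ofReal
      ((tendsto_one_div_atTop_nhds_zero_nat.const_mul _).add tendsto_const_nhds)
  refine (limsup_le_limsup hle).trans ?_
  rw [hlim.limsup_eq, mul_zero, zero_add, ENNReal.ofReal_coe_nnreal]

end Entropy

theorem measureEntropy_eq_zero_of_factor {X Y : Type*} [MeasurableSpace X] [MeasurableSpace Y]
    {T : X → X} {S : Y → Y} {μ : Measure X} {ν : Measure Y} {φ : X → Y}
    (hφ : MeasurePreserving φ μ ν) (hS : Measurable S)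
    (hsemi : Function.Semiconj φ T S) (h : measureEntropy T μ = 0) : measureEntropy S ν = 0 := by
  simp only [measureEntropy, ENNReal.iSup_eq_zero] at h ⊢
  intro r P hP
  rw [← h r (P ∘ φ) (hP.comp hφ.measurable)]
  unfold entropyOfPartition partitionEntropy
  congr! 8 with N c
  have hname : Measurable fun y => fun j : Fin N => P (S^[j] y) :=
    measurable_pi_lambda _ fun j => hP.comp (hS.iterate _)
  rw [← hφ.measureReal_preimage (hname (MeasurableSet.singleton c)).nullMeasurableSet]
  congr 1
  ext x
  simp only [Set.mem_preimage, Set.mem_singleton_iff, Function.comp_apply,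
    (hsemi.iterate_right _).eq]

open Odometer

theorem exists_periodic_partition_approx {r : ℕ} {P : Odometer → Fin r} (hP : Measurable P) {δ : ℝ}
    (hδ : 0 < δ) : ∃ Q : Odometer → Fin r, Measurable Q ∧
      (∃ q : ℕ, 0 < q ∧ ∀ x, Q (rot^[q] x) = Q x) ∧ haar.real {x | P x ≠ Q x} ≤ δ := by
  have hr : 0 < r := (P 0).pos
  have hr' : (0 : ℝ) < r := by exact_mod_cast hr
  have : Nonempty (Fin r) := ⟨⟨0, hr⟩⟩
  choose S hS hq hlt using fun c : Fin r =>
    exists_periodic_approx (hP (MeasurableSet.singleton c)) (div_pos hδ hr')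
  choose q hq hper using hq
  -- The approximating sets need not form a partition. F returns the unique index whose set contains
  -- the point when there is one, and an arbitrary index otherwise; off the symmetric differences
  -- that index is P x.
  let F : (Fin r → Prop) → Fin r := fun s => Classical.epsilon fun c => ∀ d, s d ↔ d = c
  refine ⟨fun g => F fun c => g ∈ S c, ?_, ⟨∏ c, q c, Finset.prod_pos fun c _ => hq c, fun g => ?_⟩,
    ?_⟩
  · exact (measurable_of_finite F).comp
      (measurable_pi_lambda _ fun c => measurable_mem.2 (hS c))
  · refine congrArg F (funext fun c => propext ?_)
    obtain ⟨k, hk⟩ := Finset.dvd_prod_of_mem q (Finset.mem_univ c)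
    rw [hk, rot_iterate_mul_mem_iff (hper c)]
  · have hsub : {x | P x ≠ F fun c => x ∈ S c} ⊆ ⋃ c, symmDiff (P ⁻¹' {c}) (S c) := by
      intro x hx
      by_contra hcon
      simp only [Set.mem_iUnion, not_exists, Set.mem_symmDiff, Set.mem_preimage,
        Set.mem_singleton_iff] at hcon
      have h1 : ∀ d, x ∈ S d ↔ d = P x := fun d => by
        have := hcon d
        rw [eq_comm]
        tauto
      have h2 : ∀ d, x ∈ S d ↔ d = F fun c => x ∈ S c :=
        Classical.epsilon_spec (p := fun c => ∀ d, x ∈ S d ↔ d = c) ⟨P x, h1⟩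
      exact hx ((h2 _).1 ((h1 _).2 rfl))
    refine (measureReal_mono hsub).trans ((measureReal_iUnion_fintype_le _).trans ?_)
    refine (Finset.sum_le_sum fun c _ => (hlt c).le).trans_eq ?_
    rw [Finset.sum_const, Finset.card_univ, Fintype.card_fin, nsmul_eq_mul,
      mul_div_cancel₀ _ hr'.ne']

theorem measureEntropy_rot : measureEntropy rot haar = 0 := by
  simp only [measureEntropy, ENNReal.iSup_eq_zero]
  exact fun r P hP => entropyOfPartition_eq_zero_of_periodic_approx ergodic_rot.toMeasurePreserving
    hP fun δ hδ => exists_periodic_partition_approx hP hδ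

theorem measureEntropy_mirsky (B : Set ℕ) : measureEntropy shift (mirsky B) = 0 :=
  measureEntropy_eq_zero_of_factor (measurePreserving_code B) measurable_shift (semiconj_code B)
    measureEntropy_rot

end BFree

theorem mainTheorem11 (B : Set ℕ) (hB : 0 ∉ B) :
    -- the periodic measure is the unique ergodic measure on the shift of the `m`-th truncation
    (∀ m : ℕ, ∀ μ : MeasureTheory.Measure BFree.FullShift,
      BFree.IsErgodicMeasureOn (BFree.freeShift (BFree.initialPart B m)) μ ↔
        μ = BFree.periodicMeasure (BFree.eta (BFree.initialPart B m))) ∧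
    ∃ (ν : MeasureTheory.Measure BFree.FullShift)
      (hν : BFree.IsErgodicMeasureOn (BFree.freeShift B) ν),
      Filter.Tendsto
        (fun m => BFree.ornsteinDist
          (BFree.periodicMeasure (BFree.eta (BFree.initialPart B m))) ν)
        Filter.atTop (nhds 0) ∧
      (∃ n : ℕ → ℕ, BFree.IsDavenportErdosSeq B n) ∧
      (∀ n : ℕ → ℕ, BFree.IsDavenportErdosSeq B n →
        BFree.IsQuasiGeneric BFree.shift ν n (BFree.eta B)) ∧
      BFree.HasRationalDiscreteSpectrum BFree.shift ν hν.ergodic.toMeasurePreserving ∧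
      BFree.measureEntropy BFree.shift ν = 0 := by
  have h0 : ∀ m, 0 ∉ BFree.initialPart B m := fun m h => hB (BFree.initialPart_subset B m h)
  refine ⟨fun m μ => BFree.isErgodicMeasureOn_orbitClosure_iff
      (BFree.eta_mem_periodicPts (BFree.finite_initialPart B m) (h0 m)) μ,
    BFree.mirsky B, BFree.isErgodicMeasureOn_mirsky hB, ?_,
    BFree.exists_isDavenportErdosSeq hB, fun n hn => BFree.isQuasiGeneric_mirsky hB hn,
    BFree.hasRationalDiscreteSpectrum_mirsky B, BFree.measureEntropy_mirsky B⟩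
  refine (BFree.tendsto_ornsteinDist_mirsky B).congr fun m => ?_
  rw [BFree.mirsky_eq_periodicMeasure (BFree.finite_initialPart B m) (h0 m)]
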